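/- Let $\mathbb D\subset\mathbb C$ be the open unit disc and let $\mathcal M(\mathbb D)$ be the Moebius group, i.e. the Lie group of all maps $\varphi_{a,w}(z)=w\,\frac{a-z}{1-\bar a z}$ ($a\in\mathbb D$, $|w|=1$) under composition, with the smooth structure for which $(a,w)\mapsto\varphi_{a,w}$ is a diffeomorphism from $\mathbb D\times\mathbb T$. Let $\mathcal H$ be a reproducing kernel Hilbert space of analytic functions on $\mathbb D$ with kernel functions $k_a$ ($f(a)=\langle f,k_a\rangle$). Assume: 1. $k_a\neq 0$ for every $a\in\mathbb D$, and $k_a,k_b$ are linearly independent whenever $a\ne b$; 2. $\mathcal M(\mathbb D)$ acts on $\mathcal H$ by composition operators: $f\circ\varphi^{-1}\in\mathcal H$ for all $f\in\mathcal H$, $\varphi\in\mathcal M(\mathbb D)$; 3. (boundary hypothesis) if $(w_n)$ is a sequence in $\mathbb D$ which converges in $\hat{\mathbb C}=\mathbb C\cup\{\infty\}$ to a point of $\partial\mathbb D\setminus\mathbb D$, then $k_{w_n}(z)/\|k_{w_n}\|\to 0$ for every $z\in\mathbb D$. Let $\mathrm{Gr}(\mathcal H)$ be the Grassmann manifold of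 all closed subspaces of $\mathcal H$, each identified with its orthogonal projection, so that $\mathrm{Gr}(\mathcal H)$ is a submanifold of the real Banach space $\mathcal B(\mathcal H)$ with the operator norm. Let $\mathcal Z_a=\{f\in\mathcal H: f(a)=0\}$. Then the set $\{\mathcal Z_a: a\in\mathbb D\}$ is a closed (split, embedded, $C^\infty$) submanifold of $\mathrm{Gr}(\mathcal H)$. Moreover $\varphi\cdot\mathcal Z_a:=\{f\circ\varphi^{-1}: f\in\mathcal Z_a\}=\mathcal Z_{\varphi(a)}$ for all $\varphi\in\mathcal M(\mathbb D)$ and $a\in\mathbb D$, and with this action $\{\mathcal Z_a: a\in\mathbb D\}$ is a homogeneous space of $\mathcal M(\mathbb D)$: the action is transitive and smooth, and its orbit maps $\varphi\mapsto\varphi\cdot\mathcal Z_{a}$ are submersions onto $\{\mathcal Z_a: a\in\mathbb D\}$. -/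

import Mathlib

open scoped Manifold ContDiff Topology ComplexConjugate Complex.UnitDisc

noncomputable section

namespace MoebiusGrassmann

open Complex

/-! ## The Moebius group of the unit disc as a Lie group -/

theorem moebius_den_ne_zero (a z : 𝔻) : (1 - conj (a : ℂ) * z) ≠ 0 := by
  intro h
  have h1 : ‖conj (a : ℂ) * z‖ = 1 := by rw [← sub_eq_zero.mp h]; simp
  have h2 : ‖conj (a : ℂ) * z‖ < 1 := by
    rw [norm_mul, RCLike.norm_conj]
    exact mul_lt_one_of_nonneg_of_lt_one_left (norm_nonneg _) a.norm_lt_one z.norm_lt_one.le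
  linarith

theorem moebius_norm_lt_one (a : 𝔻) (w : Circle) (z : 𝔻) :
    ‖(w : ℂ) * ((a - z) / (1 - conj (a : ℂ) * z))‖ < 1 := by
  rw [norm_mul, Circle.norm_coe, one_mul, norm_div,
    div_lt_one (norm_pos_iff.mpr (moebius_den_ne_zero a z))]
  have ha := a.normSq_lt_one
  have hz := z.normSq_lt_one
  refine lt_of_pow_lt_pow_left₀ 2 (norm_nonneg _) ?_
  rw [Complex.sq_norm, Complex.sq_norm]
  simp only [Complex.normSq_apply, Complex.sub_re, Complex.sub_im, Complex.mul_re, Complex.mul_im,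
    Complex.conj_re, Complex.conj_im, Complex.one_re, Complex.one_im] at *
  nlinarith [mul_pos (sub_pos.mpr ha) (sub_pos.mpr hz)]

/-- The Moebius transformation `φ_{a,w}(z) = w (a - z) / (1 - conj a * z)` of the unit disc. -/
def moebiusMap (a : 𝔻) (w : Circle) (z : 𝔻) : 𝔻 :=
  UnitDisc.mk ((w : ℂ) * ((a - z) / (1 - conj (a : ℂ) * z))) (moebius_norm_lt_one a w z)

theorem coe_moebiusMap (a : 𝔻) (w : Circle) (z : 𝔻) :
    (moebiusMap a w z : ℂ) = w * ((a - z) / (1 - conj (a : ℂ) * z)) := rfl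

theorem circle_mul_conj (w : Circle) : (w : ℂ) * conj (w : ℂ) = 1 := by
  rw [Complex.mul_conj, Circle.normSq_coe]; simp

/-- The inverse of `φ_{a,w}` is `φ_{wa, w⁻¹}`. -/
theorem moebiusMap_leftInverse (a : 𝔻) (w : Circle) (z : 𝔻) :
    moebiusMap (w • a) w⁻¹ (moebiusMap a w z) = z := by
  apply UnitDisc.coe_injective
  have h1 := moebius_den_ne_zero a z
  have h2 := moebius_den_ne_zero (w • a) (moebiusMap a w z)
  have h3 := moebius_den_ne_zero a a
  simp only [coe_moebiusMap, UnitDisc.coe_circle_smul, Circle.coe_inv_eq_conj, map_mul] at h2 ⊢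
  have hw := circle_mul_conj w
  have hq : (a - z : ℂ) / (1 - conj (a : ℂ) * z) * (1 - conj (a : ℂ) * z) = a - z :=
    div_mul_cancel₀ _ h1
  generalize (a - z : ℂ) / (1 - conj (a : ℂ) * z) = q at *
  rw [← mul_div_assoc, div_eq_iff h2]
  linear_combination (a - q + z * conj (a : ℂ) * q) * hw - hq

/-- The Moebius transformation `φ_{a,w}` as a bijection of the disc. -/
def moebiusPerm (a : 𝔻) (w : Circle) : Equiv.Perm 𝔻 where
  toFun := moebiusMap a w
  invFun := moebiusMap (w • a) w⁻¹
  left_inv := moebiusMap_leftInverse a w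
  right_inv z := by
    simpa only [inv_smul_smul, inv_inv] using moebiusMap_leftInverse (w • a) w⁻¹ z

/-- Inverses of Moebius transformations. -/
theorem moebiusPerm_inv (a : 𝔻) (w : Circle) :
    (moebiusPerm a w)⁻¹ = moebiusPerm (w • a) w⁻¹ := Equiv.ext fun _ => rfl

theorem coe_moebiusPerm (a : 𝔻) (w : Circle) (z : 𝔻) :
    (moebiusPerm a w z : ℂ) = w * ((a - z) / (1 - conj (a : ℂ) * z)) := rfl

theorem coe_ofConjDivSelf (z : ℂ) (hz : z ≠ 0) :
    (Circle.ofConjDivSelf z hz : ℂ) = conj z / z := rfl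

/-- The unimodular parameter of a product of two Moebius transformations. -/
def moebiusMulCircle (a : 𝔻) (w : Circle) (b : 𝔻) (v : Circle) : Circle :=
  -(w * v) * Circle.ofConjDivSelf (1 - conj (a : ℂ) * (v • b : 𝔻)) (moebius_den_ne_zero a (v • b))

theorem moebiusPerm_mul (a : 𝔻) (w : Circle) (b : 𝔻) (v : Circle) :
    moebiusPerm a w * moebiusPerm b v =
      moebiusPerm (moebiusMap (v • b) v⁻¹ a) (moebiusMulCircle a w b v) := by
  ext z
  have hv := circle_mul_conj v
  have hD1 := moebius_den_ne_zero b z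
  have hDc := moebius_den_ne_zero (v • b) a
  have hZ := moebius_den_ne_zero a (v • b)
  rw [Equiv.Perm.mul_apply, coe_moebiusPerm, coe_moebiusPerm, coe_moebiusPerm, coe_moebiusMap,
    moebiusMulCircle]
  simp only [Circle.coe_mul, Circle.coe_neg, Circle.coe_inv_eq_conj, UnitDisc.coe_circle_smul,
    map_mul, map_div₀, map_sub, map_one, Complex.conj_conj, coe_ofConjDivSelf]
    at hDc hZ ⊢
  have hx : ((b - z : ℂ) / (1 - conj (b : ℂ) * z)) * (1 - conj (b : ℂ) * z) = b - z :=
    div_mul_cancel₀ _ hD1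
  have hy := div_mul_cancel₀ (v * b - a : ℂ) hDc
  have hy' := div_mul_cancel₀ (conj (v : ℂ) * conj (b : ℂ) - conj (a : ℂ)) hZ
  have hr := div_mul_cancel₀ (1 - conj (v : ℂ) * conj (b : ℂ) * a) hZ
  have e1 : ∀ x : ℂ, x * (1 - conj (b : ℂ) * z) = b - z →
      (a - v * x : ℂ) / (1 - conj (a : ℂ) * (v * x)) =
      (a * (1 - conj (b : ℂ) * z) - v * (b - z)) /
        ((1 - conj (b : ℂ) * z) - conj (a : ℂ) * v * (b - z)) := by
    intro x hx
    rw [← mul_div_mul_right _ _ hD1]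
    congr 1
    · linear_combination (-(v : ℂ)) * hx
    · linear_combination (-conj (a : ℂ) * v) * hx
  rw [e1 _ hx]
  have e2 : ∀ y y' r : ℂ,
      y * (1 - conj (v : ℂ) * conj (b : ℂ) * a) = v * b - a →
      y' * (1 - conj (a : ℂ) * (v * b)) = conj (v : ℂ) * conj (b : ℂ) - conj (a : ℂ) →
      r * (1 - conj (a : ℂ) * (v * b)) = 1 - conj (v : ℂ) * conj (b : ℂ) * a →
      -((w : ℂ) * (v : ℂ)) * r * ((conj (v : ℂ) * y - z) / (1 - v * y' * z)) =
      (w : ℂ) * ((a * (1 - conj (b : ℂ) * z) - v * (b - z)) /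
        ((1 - conj (b : ℂ) * z) - conj (a : ℂ) * v * (b - z))) := by
    intro y y' r hy hy' hr
    rw [← mul_div_assoc, ← mul_div_assoc, ← mul_div_mul_right _ _ hZ]
    congr 1
    · linear_combination (-((w : ℂ) * v) * (conj (v : ℂ) * y - z)) * hr - (w : ℂ) * v * conj (v : ℂ) * hy
        - (w : ℂ) * (v * b - a + z * conj (b : ℂ) * a) * hv
    · linear_combination (-(v : ℂ) * z) * hy' - conj (b : ℂ) * z * hv
  rw [← e2 _ _ _ hy hy' hr, mul_comm (a : ℂ) (conj (v : ℂ) * conj (b : ℂ)),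
    mul_comm ((v : ℂ) * b) (conj (a : ℂ))]

theorem moebiusPerm_one : moebiusPerm 0 (-1) = 1 := by
  ext z
  simp [coe_moebiusPerm]

theorem moebiusPerm_injective :
    Function.Injective fun p : 𝔻 × Circle => moebiusPerm p.1 p.2 := by
  rintro ⟨a, w⟩ ⟨b, v⟩ h
  have h (z : 𝔻) : (w : ℂ) * ((a - z) / (1 - conj (a : ℂ) * z)) =
      v * ((b - z) / (1 - conj (b : ℂ) * z)) :=
    congrArg (fun φ : Equiv.Perm 𝔻 => (φ z : ℂ)) h
  have hab : a = b := by
    have h1 := h a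
    rw [sub_self, zero_div, mul_zero, eq_comm, mul_eq_zero, div_eq_zero_iff, sub_eq_zero] at h1
    rcases h1 with h1 | h1 | h1
    · exact absurd h1 v.coe_ne_zero
    · exact (UnitDisc.coe_injective h1).symm
    · exact absurd h1 (moebius_den_ne_zero b a)
  subst hab
  obtain ⟨z, hz⟩ : ∃ z : 𝔻, (a : ℂ) - z ≠ 0 := by
    by_cases ha : a = 0
    · refine ⟨UnitDisc.mk (1 / 2) (by norm_num), ?_⟩
      simp [ha]
    · exact ⟨0, by simpa using ha⟩
  have hwv : w = v :=
    Circle.coe_injective (mul_right_cancel₀ (div_ne_zero hz (moebius_den_ne_zero a z)) (h z))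
  rw [hwv]

/-- The group of Moebius transformations of the disc, i.e. of all `φ_{a,w}`, with composition as
multiplication. -/
def moebiusGroup : Subgroup (Equiv.Perm 𝔻) where
  carrier := {φ | ∃ (a : 𝔻) (w : Circle), φ = moebiusPerm a w}
  mul_mem' := by
    rintro _ _ ⟨a, w, rfl⟩ ⟨b, v, rfl⟩
    exact ⟨_, _, moebiusPerm_mul a w b v⟩
  one_mem' := ⟨0, -1, moebiusPerm_one.symm⟩
  inv_mem' := by
    rintro _ ⟨a, w, rfl⟩
    exact ⟨_, _, moebiusPerm_inv a w⟩


/-- The global coordinates `(a, w) ↦ φ_{a,w}` on the Moebius group. -/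
def moebiusCoord : 𝔻 × Circle ≃ moebiusGroup :=
  Equiv.ofBijective (fun p => ⟨moebiusPerm p.1 p.2, p.1, p.2, rfl⟩)
    ⟨fun _ _ h => moebiusPerm_injective (congrArg Subtype.val h),
      fun ⟨_, a, w, h⟩ => ⟨(a, w), Subtype.ext h.symm⟩⟩

theorem isOpenEmbedding_disc_coe : Topology.IsOpenEmbedding ((↑) : 𝔻 → ℂ) :=
  Metric.isOpen_ball.isOpenEmbedding_subtypeVal

/-- The disc with its single global chart `𝔻 ⊆ ℂ`. -/
instance : ChartedSpace ℂ 𝔻 := isOpenEmbedding_disc_coe.singletonChartedSpace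

instance : IsManifold 𝓘(ℝ, ℂ) ∞ 𝔻 := isOpenEmbedding_disc_coe.isManifold_singleton

/-- The topology of the Moebius group: the coordinates `(a, w)` form a homeomorphism. -/
instance : TopologicalSpace moebiusGroup := TopologicalSpace.induced moebiusCoord.symm inferInstance

/-- The coordinates `φ_{a,w} ↦ (a, w)` as a homeomorphism. -/
def moebiusHomeomorph : moebiusGroup ≃ₜ 𝔻 × Circle :=
  moebiusCoord.symm.toHomeomorphOfIsInducing ⟨rfl⟩

/-- The model space of `𝔻 × Circle`. -/
abbrev MoebiusModel := ModelProd ℂ (EuclideanSpace ℝ (Fin 1))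

/-- The (real, three-dimensional) model of the Moebius group. -/
abbrev moebiusI : ModelWithCorners ℝ (ℂ × EuclideanSpace ℝ (Fin 1)) MoebiusModel := 𝓘(ℝ, ℂ).prod (𝓡 1)

/-- The smooth structure of the Moebius group: the coordinates `φ_{a,w} ↦ (a, w)` form a
diffeomorphism onto `𝔻 × Circle`; the charts are those of `𝔻 × Circle` read through them. -/
instance : ChartedSpace MoebiusModel moebiusGroup where
  atlas := {e | ∃ c ∈ atlas MoebiusModel (𝔻 × Circle), e = moebiusHomeomorph.toOpenPartialHomeomorph ≫ₕ
    c}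
  chartAt φ := moebiusHomeomorph.toOpenPartialHomeomorph ≫ₕ chartAt MoebiusModel (moebiusHomeomorph φ)
  mem_chart_source φ := by simp
  chart_mem_atlas φ := ⟨_, chart_mem_atlas _ _, rfl⟩

instance : IsManifold moebiusI ∞ moebiusGroup where
  compatible := by
    rintro _ _ ⟨c, hc, rfl⟩ ⟨d, hd, rfl⟩
    have h1 := HasGroupoid.compatible (G := contDiffGroupoid ∞ moebiusI) hc hd
    have h2 : (moebiusHomeomorph.toOpenPartialHomeomorph ≫ₕ c).symm ≫ₕ
        (moebiusHomeomorph.toOpenPartialHomeomorph ≫ₕ d) = c.symm ≫ₕ d := by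
      rw [OpenPartialHomeomorph.trans_symm_eq_symm_trans_symm, OpenPartialHomeomorph.trans_assoc,
        ← OpenPartialHomeomorph.trans_assoc _ _ d, ← Homeomorph.symm_toOpenPartialHomeomorph,
        ← Homeomorph.trans_toOpenPartialHomeomorph, Homeomorph.symm_trans_self,
        Homeomorph.refl_toOpenPartialHomeomorph, OpenPartialHomeomorph.refl_trans]
    rw [h2]
    exact h1

theorem extChartAt_moebiusGroup (φ : moebiusGroup) :
    extChartAt moebiusI φ = moebiusHomeomorph.toOpenPartialHomeomorph.toPartialEquiv ≫
      extChartAt moebiusI (moebiusHomeomorph φ) := 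
  PartialEquiv.trans_assoc _ _ _

theorem contMDiff_moebiusHomeomorph : ContMDiff moebiusI moebiusI ∞ moebiusHomeomorph := by
  intro φ
  rw [contMDiffAt_iff]
  refine ⟨moebiusHomeomorph.continuous.continuousAt, ?_⟩
  have key : ∀ x ∈ (extChartAt moebiusI φ).target,
      (extChartAt moebiusI (moebiusHomeomorph φ) ∘ moebiusHomeomorph ∘
        (extChartAt moebiusI φ).symm) x = x := by
    intro x hx
    rw [extChartAt_moebiusGroup] at hx ⊢
    simpa using (extChartAt moebiusI (moebiusHomeomorph φ)).right_inv (by simpa using hx)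
  refine (contDiffWithinAt_id (𝕜 := ℝ)).congr_of_eventuallyEq ?_ ?_
  · filter_upwards [extChartAt_target_mem_nhdsWithin (I := moebiusI) φ] with x hx
    exact key x hx
  · exact key _ (mem_extChartAt_target φ)

theorem contMDiff_moebiusHomeomorph_symm : ContMDiff moebiusI moebiusI ∞ moebiusHomeomorph.symm := by
  intro p
  rw [contMDiffAt_iff]
  refine ⟨moebiusHomeomorph.symm.continuous.continuousAt, ?_⟩
  have key : ∀ x ∈ (extChartAt moebiusI p).target,
      (extChartAt moebiusI (moebiusHomeomorph.symm p) ∘ moebiusHomeomorph.symm ∘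
        (extChartAt moebiusI p).symm) x = x := by
    intro x hx
    rw [extChartAt_moebiusGroup]
    simpa using (extChartAt moebiusI p).right_inv hx
  refine (contDiffWithinAt_id (𝕜 := ℝ)).congr_of_eventuallyEq ?_ ?_
  · filter_upwards [extChartAt_target_mem_nhdsWithin (I := moebiusI) p] with x hx
    exact key x hx
  · exact key _ (mem_extChartAt_target p)

theorem contMDiff_disc_coe : ContMDiff 𝓘(ℝ, ℂ) 𝓘(ℝ, ℂ) ∞ ((↑) : 𝔻 → ℂ) :=
  contMDiff_isOpenEmbedding isOpenEmbedding_disc_coe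

theorem moebiusHomeomorph_symm_mul (p q : 𝔻 × Circle) :
    moebiusHomeomorph.symm p * moebiusHomeomorph.symm q =
      moebiusHomeomorph.symm (moebiusMap (q.2 • q.1) q.2⁻¹ p.1, moebiusMulCircle p.1 p.2 q.1 q.2) :=
  Subtype.ext (moebiusPerm_mul p.1 p.2 q.1 q.2)

theorem moebiusHomeomorph_symm_inv (p : 𝔻 × Circle) :
    (moebiusHomeomorph.symm p)⁻¹ = moebiusHomeomorph.symm (p.2 • p.1, p.2⁻¹) :=
  Subtype.ext (moebiusPerm_inv p.1 p.2)

attribute [local instance] finrank_real_complex_fact'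

section
variable {F M₀ M : Type*} [NormedAddCommGroup F] [NormedSpace ℝ F] [TopologicalSpace M₀]
  {I : ModelWithCorners ℝ F M₀} [TopologicalSpace M] [ChartedSpace M₀ M]

theorem contMDiff_disc_of_coe {f : M → 𝔻}
    (hf : ContMDiff I 𝓘(ℝ, ℂ) ∞ fun x => (f x : ℂ)) : ContMDiff I 𝓘(ℝ, ℂ) ∞ f :=
  ContMDiff.of_comp_isOpenEmbedding isOpenEmbedding_disc_coe hf

theorem contMDiff_circle_of_coe [IsManifold I ∞ M] {f : M → Circle}
    (hf : ContMDiff I 𝓘(ℝ, ℂ) ∞ fun x => (f x : ℂ)) : ContMDiff I (𝓡 1) ∞ f :=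
  ContMDiff.codRestrict_sphere hf fun x => (f x).2

theorem contMDiff_circle_coe : ContMDiff (M := Circle) (𝓡 1) 𝓘(ℝ, ℂ) ∞ ((↑) : Circle → ℂ) :=
  contMDiff_coe_sphere

theorem contMDiff_conj {f : M → ℂ} (hf : ContMDiff I 𝓘(ℝ, ℂ) ∞ f) :
    ContMDiff I 𝓘(ℝ, ℂ) ∞ fun x => conj (f x) :=
  Complex.conjCLE.contDiff.contMDiff.comp hf

theorem contMDiff_cmul {f g : M → ℂ} (hf : ContMDiff I 𝓘(ℝ, ℂ) ∞ f)
    (hg : ContMDiff I 𝓘(ℝ, ℂ) ∞ g) : ContMDiff I 𝓘(ℝ, ℂ) ∞ fun x => f x * g x :=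
  (contDiff_mul (𝕜 := ℝ) (𝔸 := ℂ)).contMDiff.comp (hf.prodMk_space hg)

theorem contMDiff_cdiv {f g : M → ℂ} (hf : ContMDiff I 𝓘(ℝ, ℂ) ∞ f)
    (hg : ContMDiff I 𝓘(ℝ, ℂ) ∞ g) (h0 : ∀ x, g x ≠ 0) :
    ContMDiff I 𝓘(ℝ, ℂ) ∞ fun x => f x / g x := by
  simp_rw [div_eq_mul_inv]
  refine contMDiff_cmul hf fun x => ?_
  exact (contDiffAt_inv ℝ (h0 x)).contMDiffAt.comp x (hg x)
end

/-- The Moebius group is a Lie group. -/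
instance : LieGroup moebiusI ∞ moebiusGroup where
  contMDiff_mul := by
    have hp1 : ContMDiff (moebiusI.prod moebiusI) 𝓘(ℝ, ℂ) ∞
        fun p : (𝔻 × Circle) × (𝔻 × Circle) => (p.1.1 : ℂ) :=
      contMDiff_disc_coe.comp (contMDiff_fst.comp contMDiff_fst)
    have hp2 : ContMDiff (moebiusI.prod moebiusI) 𝓘(ℝ, ℂ) ∞
        fun p : (𝔻 × Circle) × (𝔻 × Circle) => (p.1.2 : ℂ) :=
      contMDiff_circle_coe.comp (contMDiff_snd.comp contMDiff_fst)
    have hq1 : ContMDiff (moebiusI.prod moebiusI) 𝓘(ℝ, ℂ) ∞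
        fun p : (𝔻 × Circle) × (𝔻 × Circle) => (p.2.1 : ℂ) :=
      contMDiff_disc_coe.comp (contMDiff_fst.comp contMDiff_snd)
    have hq2 : ContMDiff (moebiusI.prod moebiusI) 𝓘(ℝ, ℂ) ∞
        fun p : (𝔻 × Circle) × (𝔻 × Circle) => (p.2.2 : ℂ) :=
      contMDiff_circle_coe.comp (contMDiff_snd.comp contMDiff_snd)
    have hqq : ContMDiff (moebiusI.prod moebiusI) 𝓘(ℝ, ℂ) ∞
        fun p : (𝔻 × Circle) × (𝔻 × Circle) => ((p.2.2 • p.2.1 : 𝔻) : ℂ) :=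
      contMDiff_cmul hq2 hq1
    have hden : ContMDiff (moebiusI.prod moebiusI) 𝓘(ℝ, ℂ) ∞
        fun p : (𝔻 × Circle) × (𝔻 × Circle) =>
          1 - conj (p.1.1 : ℂ) * ((p.2.2 • p.2.1 : 𝔻) : ℂ) :=
      contMDiff_const.sub (contMDiff_cmul (contMDiff_conj hp1) hqq)
    have hden' : ContMDiff (moebiusI.prod moebiusI) 𝓘(ℝ, ℂ) ∞
        fun p : (𝔻 × Circle) × (𝔻 × Circle) =>
          1 - conj ((p.2.2 • p.2.1 : 𝔻) : ℂ) * (p.1.1 : ℂ) :=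
      contMDiff_const.sub (contMDiff_cmul (contMDiff_conj hqq) hp1)
    have h : ContMDiff (moebiusI.prod moebiusI) moebiusI ∞
        fun p : (𝔻 × Circle) × (𝔻 × Circle) =>
          ((moebiusMap (p.2.2 • p.2.1) p.2.2⁻¹ p.1.1,
            moebiusMulCircle p.1.1 p.1.2 p.2.1 p.2.2) : 𝔻 × Circle) := by
      refine ContMDiff.prodMk (contMDiff_disc_of_coe ?_) (contMDiff_circle_of_coe ?_)
      · simp only [coe_moebiusMap, Circle.coe_inv_eq_conj]
        exact contMDiff_cmul (contMDiff_conj hq2)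
          (contMDiff_cdiv (hqq.sub hp1) hden' fun p => moebius_den_ne_zero _ _)
      · simp only [moebiusMulCircle, Circle.coe_mul, Circle.coe_neg, coe_ofConjDivSelf]
        exact contMDiff_cmul (contMDiff_cmul hp2 hq2).neg
          (contMDiff_cdiv (contMDiff_conj hden) hden fun p => moebius_den_ne_zero _ _)
    refine ((contMDiff_moebiusHomeomorph_symm.comp h).comp
      (contMDiff_moebiusHomeomorph.prodMap contMDiff_moebiusHomeomorph)).congr fun φ => ?_
    simp [← moebiusHomeomorph_symm_mul]
  contMDiff_inv := by
    have h : ContMDiff moebiusI moebiusI ∞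
        fun p : 𝔻 × Circle => ((p.2 • p.1, p.2⁻¹) : 𝔻 × Circle) := by
      refine ContMDiff.prodMk (contMDiff_disc_of_coe ?_) (contMDiff_circle_of_coe ?_)
      · simp only [UnitDisc.coe_circle_smul]
        exact contMDiff_cmul (contMDiff_circle_coe.comp contMDiff_snd)
          (contMDiff_disc_coe.comp contMDiff_fst)
      · simp only [Circle.coe_inv_eq_conj]
        exact contMDiff_conj (contMDiff_circle_coe.comp contMDiff_snd)
    refine ((contMDiff_moebiusHomeomorph_symm.comp h).comp contMDiff_moebiusHomeomorph).congr
      fun φ => ?_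
    simp [← moebiusHomeomorph_symm_inv]

/-! ## Submanifolds and homogeneous spaces inside a Banach space -/

section Submanifold

variable {E : Type*} [NormedAddCommGroup E] [NormedSpace ℝ E]

/-- `N` is a closed (split, embedded, smooth) submanifold of the submanifold `M` of the real Banach
space `E`: it is a closed subset of `M`, and near each of its points `p` a diffeomorphism `Ψ`
between open subsets of `E` carries `M` to a closed complemented linear subspace `T` of `E` (so it
restricts to a chart of `M` with values in `T`) and carries `N` to a closed complemented linear
subspace `S` of `T`. -/
structure IsClosedSubmanifold (N M : Set E) : Prop where
  subset : N ⊆ M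
  isClosed : IsClosed (Subtype.val ⁻¹' N : Set M)
  exists_chart : ∀ p ∈ N, ∃ (Ψ : OpenPartialHomeomorph E E) (S T : Submodule ℝ E),
    p ∈ Ψ.source ∧ ContDiffOn ℝ ∞ Ψ Ψ.source ∧ ContDiffOn ℝ ∞ Ψ.symm Ψ.target ∧
    S ≤ T ∧ S.ClosedComplemented ∧ T.ClosedComplemented ∧
    (∀ x ∈ Ψ.source, Ψ x ∈ T ↔ x ∈ M) ∧ (∀ x ∈ Ψ.source, Ψ x ∈ S ↔ x ∈ N)

/-- The tangent space at `p` of a submanifold `N` of `E`: the velocities at `p` of curves in `N`. -/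
def tangentVectors (N : Set E) (p : E) : Set E :=
  {v | ∃ γ : ℝ → E, γ 0 = p ∧ (∀ t, γ t ∈ N) ∧ HasDerivAt γ v 0}

/-- The submanifold `N` of `E` is a homogeneous space of the Lie group `G` for the action `act`:
`act` restricts to an action of `G` on `N` which is transitive and smooth as a map `G × N → N`, and
the orbit maps `G → N`, `g ↦ act g p`, are submersions (their differentials map onto the tangent
spaces of `N` and have complemented kernels). On a submanifold `N`, `ContMDiffOn` is smoothness in
the charts of `N`. -/
structure IsHomogeneousSpace {F G₀ : Type*} [NormedAddCommGroup F] [NormedSpace ℝ F]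
    [TopologicalSpace G₀] (I : ModelWithCorners ℝ F G₀) (G : Type*) [TopologicalSpace G]
    [ChartedSpace G₀ G] [Group G] [LieGroup I ∞ G] (act : G → E → E) (N : Set E) : Prop where
  nonempty : N.Nonempty
  mapsTo : ∀ g : G, ∀ p ∈ N, act g p ∈ N
  one_act : ∀ p ∈ N, act 1 p = p
  mul_act : ∀ g h : G, ∀ p ∈ N, act (g * h) p = act g (act h p)
  transitive : ∀ p ∈ N, ∀ q ∈ N, ∃ g : G, act g p = q
  smooth : ContMDiffOn (I.prod 𝓘(ℝ, E)) 𝓘(ℝ, E) ∞ (fun x : G × E => act x.1 x.2)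
    (Set.univ ×ˢ N)
  surjective_mfderiv : ∀ p ∈ N, ∀ g : G,
    Set.range (mfderiv I 𝓘(ℝ, E) (fun h : G => act h p) g) = tangentVectors N (act g p)
  split_mfderiv : ∀ p ∈ N, ∀ g : G,
    (mfderiv I 𝓘(ℝ, E) (fun h : G => act h p) g).ker.ClosedComplemented

end Submanifold

/-! ## Reproducing kernel Hilbert spaces and the Grassmann manifold -/

section Grassmann

variable (H : Type*) [NormedAddCommGroup H] [InnerProductSpace ℂ H] [CompleteSpace H]

/-- The Grassmann manifold of `H`, a subset of the (real) Banach space of bounded operators: a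
closed subspace of `H` is identified with its orthogonal projection. -/
def grassmannian : Set (H →L[ℂ] H) := {P | IsStarProjection P}

variable {H} in
/-- The orthogonal projection onto (the closure of) a linear subspace. -/
def projOnto (S : Submodule ℂ H) : H →L[ℂ] H := S.topologicalClosure.starProjection

variable {X : Type*} [RKHS ℂ H X ℂ]

/-- The reproducing kernel `k_a ∈ H` at the point `a`. -/
def kernelAt (a : X) : H := RKHS.kerFun H a 1

/-- The boundary hypothesis on a reproducing kernel Hilbert space of functions on a subset `X` of
`Y`, with inclusion `ι`: if `w_n` is a sequence in `X` which converges, in the one-point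
compactification of `Y`, to a point of the boundary of `X` outside `X`, then
`k_{w_n}(z) / ‖k_{w_n}‖ → 0` for all `z ∈ X`. -/
def BoundaryHypothesis {Y : Type*} [TopologicalSpace Y] (ι : X → Y) : Prop :=
  let j : X → OnePoint Y := fun x => (ι x : OnePoint Y)
  ∀ (w : ℕ → X) (p : OnePoint Y), p ∈ frontier (Set.range j) \ Set.range j →
    Filter.Tendsto (fun n => j (w n)) Filter.atTop (𝓝 p) →
    ∀ z : X, Filter.Tendsto (fun n => kernelAt H (w n) z / (‖kernelAt H (w n)‖ : ℂ))
      Filter.atTop (𝓝 0)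

/-- The closed subspace `Z_a` of the functions in `H` which vanish at `a`. -/
def zeroSpace (a : X) : Submodule ℂ H where
  carrier := {f | f a = 0}
  add_mem' := by
    intro f g hf hg
    simp only [Set.mem_ofPred_eq] at hf hg ⊢
    simp [hf, hg]
  zero_mem' := by simp
  smul_mem' := by
    intro c f hf
    simp only [Set.mem_ofPred_eq] at hf ⊢
    simp [hf]

/-- The set of the subspaces `Z_a`, `a ∈ X`, in the Grassmann manifold. -/
def zeroSpaces : Set (H →L[ℂ] H) := Set.range fun a : X => projOnto (zeroSpace H a)

end Grassmann

section Action

variable (H : Type*) [NormedAddCommGroup H] [InnerProductSpace ℂ H] [CompleteSpace H]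
  [RKHS ℂ H 𝔻 ℂ]

/-- The functions of `H` are analytic on the disc. -/
def ConsistsOfAnalytic : Prop :=
  ∀ f : H, ∃ F : ℂ → ℂ, AnalyticOnNhd ℂ F (Metric.ball 0 1) ∧ ∀ z : 𝔻, f z = F z

/-- The Moebius group acts on `H` by composition operators: `f ∘ φ⁻¹ ∈ H` whenever `f ∈ H` and `φ`
is a Moebius transformation. -/
def MoebiusActs : Prop :=
  ∀ (φ : moebiusGroup) (f : H), ∃ g : H, ∀ z : 𝔻, g z = f ((φ⁻¹ : moebiusGroup).1 z)

variable {H}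

/-- The subspace `C_{φ⁻¹}(S) = {f ∘ φ⁻¹ | f ∈ S}`. -/
def translate (φ : moebiusGroup) (S : Submodule ℂ H) : Submodule ℂ H where
  carrier := {g | ∃ f ∈ S, ∀ z : 𝔻, g z = f ((φ⁻¹ : moebiusGroup).1 z)}
  add_mem' := by
    rintro g₁ g₂ ⟨f₁, hf₁, h₁⟩ ⟨f₂, hf₂, h₂⟩
    exact ⟨f₁ + f₂, S.add_mem hf₁ hf₂, fun z => by simp [h₁, h₂]⟩
  zero_mem' := ⟨0, S.zero_mem, fun z => by simp⟩
  smul_mem' := by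
    rintro c g ⟨f, hf, h⟩
    exact ⟨c • f, S.smul_mem c hf, fun z => by simp [h]⟩

/-- The action `φ · S = C_{φ⁻¹}(S)` on subspaces, written for the corresponding projections. -/
def moebiusAct (φ : moebiusGroup) (P : H →L[ℂ] H) : H →L[ℂ] H :=
  projOnto (translate φ P.range)

end Action

end MoebiusGrassmann

end

open MoebiusGrassmann

/-! By the reproducing property `Z_a` is the orthogonal complement of `k_a`, so it corresponds to
the projection `P_a = 1 - ‖k_a‖⁻² ⟨k_a, ·⟩ k_a`, and everything is a statement about the map `a ↦
P_a`. The theorem holds because this map is a smooth, injective, closed immersion of the disc which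
intertwines the two Moebius actions.

Smoothness: `a ↦ k_a` is weakly, hence strongly, antiholomorphic
(`differentiableOn_of_weakly_differentiableOn`). Injectivity is the pairwise independence of the
kernels. Immersion (`fderiv_zeroProjection_injective`): a tangent vector killed at one point would
force every function with a zero there to have a double zero; the Moebius action spreads this to all
points, Wronskians then vanish, and all quotients `f / k_0` are constant near `0`, which makes
nearby kernels proportional. Closedness (`isClosedEmbedding_zeroProjection`): if `b_n` tends to the
unit circle while `P_{b_n}` converges, the boundary hypothesis makes the limit of the rank-one
projections `1 - P_{b_n}` vanish on all kernels, hence be zero, although each has norm one.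

The Grassmannian is straightened near `p` by keeping the off-diagonal blocks of `x` and replacing
the diagonal blocks by those of `x ^ 2 - x` (`projectionChart_mem_iff`). Composing with a correction
that linearises the embedded disc gives charts adapted to both sets (`exists_submanifold_chart`).
Finally, `φ · Z_a = Z_{φ(a)}` and smooth local left inverses of `a ↦ P_a` transfer transitivity,
smoothness and submersivity from the action on the disc. -/

/-! ### Inverse function theorem, local retractions and adapted charts -/

section SmoothCharts

variable {V E : Type*} [NormedAddCommGroup V] [NormedSpace ℝ V]
  [NormedAddCommGroup E] [NormedSpace ℝ E]

/-- The inverse function theorem, with smoothness on the whole source and target. -/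
theorem exists_contDiffOn_openPartialHomeomorph [CompleteSpace V] {f : V → E} {U : Set V}
    (hU : IsOpen U) {p : V} (hp : p ∈ U) (hf : ContDiffOn ℝ ∞ f U) (J : V ≃L[ℝ] E)
    (hJ : HasFDerivAt f (J : V →L[ℝ] E) p) :
    ∃ Ψ : OpenPartialHomeomorph V E, p ∈ Ψ.source ∧ Ψ.source ⊆ U ∧ ⇑Ψ = f ∧
      ContDiffOn ℝ ∞ Ψ Ψ.source ∧ ContDiffOn ℝ ∞ Ψ.symm Ψ.target := by
  have hfp : ContDiffAt ℝ ∞ f p := hf.contDiffAt (hU.mem_nhds hp)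
  have hn : (∞ : ℕ∞ω) ≠ 0 := by simp
  have hcont : ContinuousOn (fderiv ℝ f) U := hf.continuousOn_fderiv_of_isOpen hU (by simp)
  -- Invertibility of the derivative is an open condition; restricting to this set makes the inverse
  -- smooth on the whole target, not only near `f p`.
  have hV : IsOpen (U ∩ fderiv ℝ f ⁻¹' Set.range ((↑) : (V ≃L[ℝ] E) → V →L[ℝ] E)) :=
    hcont.isOpen_inter_preimage hU ContinuousLinearEquiv.isOpen
  set R := hfp.toOpenPartialHomeomorph f hJ hn with hR
  have hRf : ⇑R = f := hfp.toOpenPartialHomeomorph_coe hJ hn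
  refine ⟨R.restrOpen _ hV, ?_, ?_, ?_, ?_, ?_⟩
  · rw [OpenPartialHomeomorph.restrOpen_source]
    exact ⟨hfp.mem_toOpenPartialHomeomorph_source hJ hn, hp, J, hJ.fderiv.symm⟩
  · rw [OpenPartialHomeomorph.restrOpen_source]
    exact fun x hx => hx.2.1
  · simpa using hRf
  · rw [OpenPartialHomeomorph.restrOpen_source]
    have : ⇑(R.restrOpen _ hV) = f := by simpa using hRf
    rw [this]
    exact hf.mono fun x hx => hx.2.1
  · intro y hy
    have hsrc := (R.restrOpen _ hV).map_target hy
    rw [OpenPartialHomeomorph.restrOpen_source] at hsrc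
    have hcoe : ⇑(R.restrOpen _ hV) = f := by simpa using hRf
    obtain ⟨-, hxU, J', hJ'⟩ := hsrc
    have hfx := hf.contDiffAt (hU.mem_nhds hxU)
    refine (OpenPartialHomeomorph.contDiffAt_symm _ hy (f₀' := J') ?_ ?_).contDiffWithinAt
    · rw [hcoe, hJ']
      exact (hfx.differentiableAt (by simp)).hasFDerivAt
    · rw [hcoe]
      exact hfx

/-- An immersion which is a homeomorphism onto its image has smooth local retractions. -/
theorem exists_smooth_retraction [CompleteSpace V] {F : V → E} {U : Set V} (hU : IsOpen U)
    (hF : ContDiffOn ℝ ∞ F U) (hinj : Set.InjOn F U) {a : V} (ha : a ∈ U)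
    (himm : (fderiv ℝ F a).HasLeftInverse)
    (hopen : ∀ O ∈ 𝓝 a, F '' (U ∩ O) ∈ 𝓝[F '' U] F a) :
    ∃ (W : Set E) (ρ : E → V), IsOpen W ∧ F a ∈ W ∧ ContDiffOn ℝ ∞ ρ W ∧ Set.MapsTo ρ W U ∧
      (∀ x ∈ W, x ∈ F '' U ↔ F (ρ x) = x) ∧ ∀ b ∈ U, F b ∈ W → ρ (F b) = b := by
  obtain ⟨l, hl⟩ := himm
  have hFa := hF.contDiffAt (hU.mem_nhds ha)
  have hd : HasFDerivAt (l ∘ F) ((ContinuousLinearEquiv.refl ℝ V : V ≃L[ℝ] V) : V →L[ℝ] V) a := by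
    have h := l.hasFDerivAt.comp a (hFa.differentiableAt (by simp)).hasFDerivAt
    convert h using 1
    ext v
    exact (hl v).symm
  obtain ⟨Ψ, haΨ, hΨU, hΨ, -, hsymm⟩ := exists_contDiffOn_openPartialHomeomorph hU ha
    (l.contDiff.comp_contDiffOn hF) _ hd
  have hval (b : V) : Ψ b = l (F b) := congrFun hΨ b
  -- Since `l ∘ F` has derivative the identity at `a`, its local inverse composed with `l` is the
  -- retraction. The openness of `F` onto its image excludes distant pieces of `F '' U` returning
  -- close to `F a`.
  have hmem := hopen Ψ.source (Ψ.open_source.mem_nhds haΨ)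
  obtain ⟨W', hW', haW', hsub⟩ := mem_nhdsWithin.mp hmem
  have hiff : ∀ x ∈ W' ∩ l ⁻¹' Ψ.target, x ∈ F '' U ↔ F (Ψ.symm (l x)) = x := by
    rintro x ⟨hx, hxt⟩
    constructor
    · intro hxF
      obtain ⟨b, ⟨-, hb⟩, rfl⟩ := hsub ⟨hx, hxF⟩
      rw [← hval, Ψ.left_inv hb]
    · exact fun h => ⟨_, hΨU (Ψ.map_target hxt), h⟩
  refine ⟨W' ∩ l ⁻¹' Ψ.target, Ψ.symm ∘ l, hW'.inter (Ψ.open_target.preimage l.continuous),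
    ⟨haW', ?_⟩, ?_, ?_, hiff, ?_⟩
  · rw [Set.mem_preimage, ← hval]
    exact Ψ.map_source haΨ
  · exact hsymm.comp l.contDiff.contDiffOn fun x hx => hx.2
  · exact fun x hx => hΨU (Ψ.map_target hx.2)
  · intro b hb hbW
    exact hinj (hΨU (Ψ.map_target hbW.2)) hb ((hiff _ hbW).mp ⟨b, hb, rfl⟩)

/-- An immersed and embedded subset of a submanifold `M`, the latter straightened by `Φ`, admits
submanifold charts. -/
theorem exists_submanifold_chart [CompleteSpace V] [CompleteSpace E] {F : V → E} {U : Set V}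
    (hU : IsOpen U) (hF : ContDiffOn ℝ ∞ F U) (hinj : Set.InjOn F U) {a : V} (ha : a ∈ U)
    (himm : (fderiv ℝ F a).HasLeftInverse)
    (hopen : ∀ O ∈ 𝓝 a, F '' (U ∩ O) ∈ 𝓝[F '' U] F a)
    {M : Set E} (hFM : F '' U ⊆ M) {Φ : E → E} {O : Set E} (hO : IsOpen O) (haO : F a ∈ O)
    (hΦ : ContDiffOn ℝ ∞ Φ O) (J : E ≃L[ℝ] E) (hJ : HasFDerivAt Φ (J : E →L[ℝ] E) (F a))
    {T : Submodule ℝ E} (hT : T.ClosedComplemented) (hTM : ∀ x ∈ O, Φ x ∈ T ↔ x ∈ M) :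
    ∃ (Ψ : OpenPartialHomeomorph E E) (S T : Submodule ℝ E),
      F a ∈ Ψ.source ∧ ContDiffOn ℝ ∞ Ψ Ψ.source ∧ ContDiffOn ℝ ∞ Ψ.symm Ψ.target ∧
      S ≤ T ∧ S.ClosedComplemented ∧ T.ClosedComplemented ∧
      (∀ x ∈ Ψ.source, Ψ x ∈ T ↔ x ∈ M) ∧ (∀ x ∈ Ψ.source, Ψ x ∈ S ↔ x ∈ F '' U) := by
  obtain ⟨W, ρ, hW, haW, hρ, hρU, hρiff, hρF⟩ :=
    exists_smooth_retraction hU hF hinj ha himm hopen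
  have hρa : ρ (F a) = a := hρF a ha haW
  have hFa := hF.contDiffAt (hU.mem_nhds ha)
  have hFa' : HasFDerivAt F (fderiv ℝ F a) a := (hFa.differentiableAt (by simp)).hasFDerivAt
  have hρa' : HasFDerivAt ρ (fderiv ℝ ρ (F a)) (F a) :=
    ((hρ.contDiffAt (hW.mem_nhds haW)).differentiableAt (by simp)).hasFDerivAt
  set D : V →L[ℝ] E := (J : E →L[ℝ] E) ∘L fderiv ℝ F a with hD
  have hDinv : D.HasLeftInverse := J.hasLeftInverse.comp himm
  have hDderiv : HasFDerivAt (Φ ∘ F) D a := hJ.comp a hFa'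
  have hDT (v : V) : D v ∈ T := by
    obtain ⟨f, hf⟩ := hT
    -- `τ` vanishes on `T`, and `Φ ∘ F` takes values in `T` near `a`; so `τ ∘L D = 0`, which says
    -- that `D v` is fixed by the projection onto `T`.
    set τ : E →L[ℝ] E := T.subtypeL ∘L f - ContinuousLinearMap.id ℝ E
    have h1 : HasFDerivAt (τ ∘ (Φ ∘ F)) (τ ∘L D) a := τ.hasFDerivAt.comp a hDderiv
    have h2 : HasFDerivAt (τ ∘ (Φ ∘ F)) (0 : V →L[ℝ] E) a := by
      refine (hasFDerivAt_const (0 : E) a).congr_of_eventuallyEq ?_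
      filter_upwards [hU.mem_nhds ha, hFa.continuousAt.preimage_mem_nhds (hO.mem_nhds haO)]
        with b hbU hbO
      have hmem : Φ (F b) ∈ T := (hTM _ hbO).mpr (hFM ⟨b, hbU, rfl⟩)
      simp [τ, hf ⟨_, hmem⟩]
    have h3 := congrArg (fun L : V →L[ℝ] E => L v) (h1.unique h2)
    have h4 : (f (D v) : E) - D v = 0 := h3
    rw [← sub_eq_zero.mp h4]
    exact (f (D v)).2
  set O' : Set E := O ∩ (W ∩ (F ∘ ρ) ⁻¹' O) with hO'
  have hFρ : ContDiffOn ℝ ∞ (F ∘ ρ) W := hF.comp hρ hρU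
  have hO'open : IsOpen O' := hO.inter (hFρ.continuousOn.isOpen_inter_preimage hW hO)
  have haO' : F a ∈ O' := ⟨haO, haW, by simpa [hρa] using haO⟩
  -- Replace the part `Φ ∘ F ∘ ρ` of `Φ` by its linearisation. The derivative at `F a` stays `J`,
  -- the change lies in `T` so that `M` is still straightened, and `F b` is now sent to `D (b - a)`.
  set ψ : E → E := fun x => Φ x - Φ (F (ρ x)) + D (ρ x - a) with hψ
  have hψsmooth : ContDiffOn ℝ ∞ ψ O' := by
    refine ((hΦ.mono fun x hx => hx.1).sub ?_).add ?_
    · exact hΦ.comp (hFρ.mono fun x hx => hx.2.1) fun x hx => hx.2.2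
    · exact D.contDiff.comp_contDiffOn ((hρ.mono fun x hx => hx.2.1).sub contDiffOn_const)
  have hψderiv : HasFDerivAt ψ (J : E →L[ℝ] E) (F a) := by
    have h1 : HasFDerivAt (fun x => Φ (F (ρ x))) (D ∘L fderiv ℝ ρ (F a)) (F a) := by
      refine HasFDerivAt.comp (g := Φ ∘ F) (F a) ?_ hρa'
      rwa [hρa]
    have h2 : HasFDerivAt (fun x => D (ρ x - a)) (D ∘L fderiv ℝ ρ (F a)) (F a) :=
      D.hasFDerivAt.comp (F a) (hρa'.sub_const a)
    have h3 := (hJ.sub h1).add h2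
    rw [sub_add_cancel] at h3
    exact h3
  obtain ⟨R, haR, hRO, hR, hRs, hRt⟩ := exists_contDiffOn_openPartialHomeomorph hO'open haO'
    hψsmooth J hψderiv
  obtain ⟨Λ, hΛ⟩ := hDinv
  -- The shrinking needed for the converse: when `ψ x = D z`, it guarantees that `F (a + z)` lies in
  -- `R.source`, where injectivity of `ψ` identifies it with `x`.
  set B : Set E := R.source ∩ ψ ⁻¹' (Λ ⁻¹' ((fun z => a + z) ⁻¹' (U ∩ F ⁻¹' R.source))) with hB
  have hBopen : IsOpen B := by
    refine (hψsmooth.continuousOn.mono hRO).isOpen_inter_preimage R.open_source ?_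
    refine ((hF.continuousOn.isOpen_inter_preimage hU R.open_source).preimage ?_).preimage
      Λ.continuous
    fun_prop
  have hsrc : (R.restrOpen B hBopen).source = B := by
    rw [OpenPartialHomeomorph.restrOpen_source, hB, ← Set.inter_assoc, Set.inter_self]
  have hcoe : ⇑(R.restrOpen B hBopen) = ψ := by simpa using hR
  have hψN (b : V) (hb : b ∈ U) (hbW : F b ∈ W) : ψ (F b) = D (b - a) := by
    simp [hψ, hρF b hb hbW]
  refine ⟨R.restrOpen B hBopen, D.range, T, ?_, ?_, ?_, ?_, ?_, hT, ?_, ?_⟩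
  · rw [hsrc]
    refine ⟨haR, ?_⟩
    simp [hψN a ha haW, ha, haR]
  · rw [hsrc, hcoe]
    exact hψsmooth.mono fun x hx => hRO hx.1
  · exact hRt.mono (by simp [OpenPartialHomeomorph.restrOpen])
  · rintro _ ⟨v, rfl⟩
    exact hDT v
  · exact ContinuousLinearMap.HasLeftInverse.closedComplemented_range ⟨Λ, hΛ⟩
  · rw [hsrc, hcoe]
    rintro x ⟨hx, -⟩
    obtain ⟨hxO, hxW, hxO'⟩ := hRO hx
    rw [← hTM x hxO]
    have h1 : Φ (F (ρ x)) ∈ T := (hTM _ hxO').mpr (hFM ⟨_, hρU hxW, rfl⟩)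
    have h2 : ψ x = Φ x - (Φ (F (ρ x)) - D (ρ x - a)) := by simp only [hψ]; abel
    rw [h2, T.sub_mem_iff_left (T.sub_mem h1 (hDT _))]
  · rw [hsrc, hcoe]
    rintro x ⟨hx, hxB⟩
    have hxW := (hRO hx).2.1
    constructor
    · rintro ⟨z, hz⟩
      have hz' : D z = ψ x := hz
      have hΛz : Λ (ψ x) = z := by rw [← hz']; exact hΛ z
      simp only [Set.mem_preimage, hΛz] at hxB
      have h1 : ψ (F (a + z)) = ψ x := by
        rw [hψN _ hxB.1 (hRO hxB.2).2.1, add_sub_cancel_left, hz']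
      have h2 := R.injOn hxB.2 hx (by rw [hR]; exact h1)
      exact ⟨_, hxB.1, h2⟩
    · rintro ⟨b, hb, rfl⟩
      exact ⟨b - a, (hψN b hb hxW).symm⟩

end SmoothCharts

/-! ### Straightening the manifold of projections -/

section GrassmannianChart

variable {A : Type*} [NormedRing A]

/-- If `x` commutes with `x ^ 2 - x`, and the latter has vanishing diagonal blocks, then so does its
off-diagonal block, provided that `x` is close to `p`. -/
theorem corner_eq_zero {p q x y : A} (hp : p * p = p) (hq : q * q = q) (hpq : p + q = 1)
    (hxy : x * y = y * x) (hyp : p * y * p = 0) (hyq : q * y * q = 0)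
    (h1 : ‖p * (x - p) * p‖ < 1 / 2) (h2 : ‖q * (x - p) * q‖ < 1 / 2) :
    p * y * q = 0 ∧ q * y * p = 0 := by
  have hq' : q = 1 - p := eq_sub_of_add_eq' hpq
  have hpq0 : p * q = 0 := by rw [hq', mul_sub, hp]; simp
  have hqp0 : q * p = 0 := by rw [hq', sub_mul, hp]; simp
  set a := p * (x - p) * p with ha
  set d := q * (x - p) * q with hd
  -- Compare the `p`-`q` corners of `x * y` and `y * x`. As the diagonal corners of `y` vanish and
  -- `p * x * p = p + a`, `q * x * q = d`, the corner `b` of `y` satisfies `b + a * b = b * d`;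
  -- since `‖a‖ + ‖d‖ < 1`, this forces `b = 0`.
  have key1 : p * y * q = (p * y * q) * d - a * (p * y * q) := by
    have e1 : p * (x * y) * q = (p * x * p) * y * q + p * x * (q * y * q) := by
      have : p * (x * y) * q = p * x * (p + q) * y * q := by rw [hpq]; noncomm_ring
      rw [this]
      have : p * x * (p + q) * y * q = (p * x * p) * y * q + p * x * (q * y * q) := by noncomm_ring
      exact this
    have e2 : p * (y * x) * q = (p * y * p) * x * q + p * y * (q * x * q) := by
      have : p * (y * x) * q = p * y * (p + q) * x * q := by rw [hpq]; noncomm_ring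
      rw [this]
      noncomm_ring
    have e3 : p * x * p = p + a := by
      rw [ha, mul_sub, sub_mul, hp, hp]; abel
    have e4 : q * x * q = d := by
      rw [hd, mul_sub, sub_mul, hqp0, zero_mul, sub_zero]
    rw [hyq, mul_zero, add_zero, e3] at e1
    rw [hyp, zero_mul, zero_mul, zero_add, e4, ← hxy, e1] at e2
    have e5 : a * (p * y * q) = a * y * q := by
      have : a * p = a := by rw [ha, mul_assoc, hp]
      rw [← mul_assoc, ← mul_assoc, this]
    have e6 : p * y * q * d = p * y * d := by
      have : q * d = d := by rw [hd, ← mul_assoc, ← mul_assoc, hq]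
      rw [mul_assoc, this]
    rw [e5, e6, ← e2]
    noncomm_ring
  have key2 : q * y * p = d * (q * y * p) - (q * y * p) * a := by
    have e1 : q * (x * y) * p = (q * x * q) * y * p + q * x * (p * y * p) := by
      have : q * (x * y) * p = q * x * (p + q) * y * p := by rw [hpq]; noncomm_ring
      rw [this]
      noncomm_ring
    have e2 : q * (y * x) * p = (q * y * q) * x * p + q * y * (p * x * p) := by
      have : q * (y * x) * p = q * y * (p + q) * x * p := by rw [hpq]; noncomm_ring
      rw [this]
      noncomm_ring
    have e3 : p * x * p = p + a := by
      rw [ha, mul_sub, sub_mul, hp, hp]; abel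
    have e4 : q * x * q = d := by
      rw [hd, mul_sub, sub_mul, hqp0, zero_mul, sub_zero]
    rw [hyp, mul_zero, add_zero, e4] at e1
    rw [hyq, zero_mul, zero_mul, zero_add, e3, ← hxy, e1] at e2
    have e5 : d * (q * y * p) = d * y * p := by
      have : d * q = d := by rw [hd, mul_assoc, hq]
      rw [← mul_assoc, ← mul_assoc, this]
    have e6 : q * y * p * a = q * y * a := by
      have : p * a = a := by rw [ha, ← mul_assoc, ← mul_assoc, hp]
      rw [mul_assoc, this]
    rw [e5, e6, e2]
    noncomm_ring
  have small (z s t : A) (hz : z = s - t) (hs : ‖s‖ ≤ ‖z‖ * ‖d‖) (ht : ‖t‖ ≤ ‖z‖ * ‖a‖) : z = 0 := by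
    have h3 : ‖z‖ ≤ ‖z‖ * ‖d‖ + ‖z‖ * ‖a‖ := by
      nth_rw 1 [hz]
      exact (norm_sub_le s t).trans (add_le_add hs ht)
    by_contra hne
    have hpos := norm_pos_iff.mpr hne
    nlinarith
  constructor
  · exact small _ _ _ key1 (norm_mul_le _ _) ((norm_mul_le _ _).trans_eq (mul_comm _ _))
  · exact small _ _ _ key2 ((norm_mul_le _ _).trans_eq (mul_comm _ _)) (norm_mul_le _ _)

variable [NormedAlgebra ℝ A]

/-- The map which straightens the manifold of projections near `p`. -/
def projectionChart (p x : A) : A :=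
  p * x * (1 - p) + (1 - p) * x * p + p * (x * x - x) * p + (1 - p) * (x * x - x) * (1 - p)

/-- The derivative of `projectionChart p` at `p`. -/
noncomputable def projectionChartDeriv (p : A) : A →L[ℝ] A :=
  ContinuousLinearMap.mulLeftRight ℝ A p (1 - p) + ContinuousLinearMap.mulLeftRight ℝ A (1 - p) p
    + ContinuousLinearMap.mulLeftRight ℝ A p p
    - ContinuousLinearMap.mulLeftRight ℝ A (1 - p) (1 - p)

theorem projectionChartDeriv_apply (p h : A) : projectionChartDeriv p h =
    p * h * (1 - p) + (1 - p) * h * p + p * h * p - (1 - p) * h * (1 - p) := rfl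

/-- In block form with respect to `p` and `1 - p` the map only changes the sign of the block at `1 -
p`. -/
theorem projectionChartDeriv_involutive {p : A} (hp : p * p = p) :
    Function.Involutive (projectionChartDeriv p) := by
  intro h
  have hp' (z : A) : p * (p * z) = p * z := by rw [← mul_assoc, hp]
  simp only [projectionChartDeriv_apply, mul_sub, sub_mul, mul_add, add_mul, one_mul, mul_one,
    mul_assoc, hp, hp']
  abel

/-- The derivative of `projectionChart p` at a projection `p`, which is an involution. -/
noncomputable def projectionChartDerivEquiv {p : A} (hp : p * p = p) : A ≃L[ℝ] A :=
  ContinuousLinearEquiv.equivOfInverse (projectionChartDeriv p) (projectionChartDeriv p)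
    (projectionChartDeriv_involutive hp) (projectionChartDeriv_involutive hp)

theorem contDiff_projectionChart (p : A) : ContDiff ℝ ∞ (projectionChart p) := by
  unfold projectionChart
  fun_prop

/-- The derivative of `x * x - x` at `p` is `h ↦ p * h + h * p - h`, whose diagonal blocks are `p *
h * p` and `-(1 - p) * h * (1 - p)`. -/
theorem hasFDerivAt_projectionChart {p : A} (hp : p * p = p) :
    HasFDerivAt (projectionChart p) (projectionChartDerivEquiv hp : A →L[ℝ] A) p := by
  have hid := hasFDerivAt_id (𝕜 := ℝ) p
  have hsq := (hid.mul' hid).sub hid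
  have h1 := (ContinuousLinearMap.mulLeftRight ℝ A p (1 - p)).hasFDerivAt.comp p hid
  have h2 := (ContinuousLinearMap.mulLeftRight ℝ A (1 - p) p).hasFDerivAt.comp p hid
  have h3 := (ContinuousLinearMap.mulLeftRight ℝ A p p).hasFDerivAt.comp p hsq
  have h4 := (ContinuousLinearMap.mulLeftRight ℝ A (1 - p) (1 - p)).hasFDerivAt.comp p hsq
  refine (((h1.add h2).add h3).add h4).congr_fderiv ?_
  ext h
  have hp' (z : A) : p * (p * z) = p * z := by rw [← mul_assoc, hp]
  change _ = projectionChartDeriv p h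
  rw [projectionChartDeriv_apply]
  simp only [add_apply, ContinuousLinearMap.comp_apply,
    sub_apply, ContinuousLinearMap.mulLeftRight_apply,
    smul_apply, ContinuousLinearMap.id_apply, id_eq, smul_eq_mul,
    MulOpposite.smul_eq_mul_unop, MulOpposite.unop_op]
  simp only [mul_sub, sub_mul, mul_add, add_mul, one_mul, mul_one, mul_assoc, hp, hp']
  abel

/-- The tangent space at `p` of the manifold of projections: the self-adjoint off-diagonal
elements. -/
def offDiagonal [StarRing A] [StarModule ℝ A] (p : A) : Submodule ℝ A where
  carrier := {x | p * x * p = 0 ∧ (1 - p) * x * (1 - p) = 0 ∧ star x = x}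
  add_mem' := by
    rintro x y ⟨h1, h2, h3⟩ ⟨h4, h5, h6⟩
    refine ⟨?_, ?_, ?_⟩
    · rw [mul_add, add_mul, h1, h4, add_zero]
    · rw [mul_add, add_mul, h2, h5, add_zero]
    · rw [star_add, h3, h6]
  zero_mem' := by simp
  smul_mem' := by
    rintro c x ⟨h1, h2, h3⟩
    refine ⟨?_, ?_, ?_⟩
    · rw [mul_smul_comm, smul_mul_assoc, h1, smul_zero]
    · rw [mul_smul_comm, smul_mul_assoc, h2, smul_zero]
    · rw [star_smul, h3, star_trivial]

theorem mem_offDiagonal [StarRing A] [StarModule ℝ A] {p x : A} :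
    x ∈ offDiagonal p ↔ p * x * p = 0 ∧ (1 - p) * x * (1 - p) = 0 ∧ star x = x := Iff.rfl

/-- The continuous projection is: take the self-adjoint part, then discard the diagonal blocks. -/
theorem offDiagonal_closedComplemented [StarRing A] [NormedStarGroup A] [StarModule ℝ A] {p : A}
    (hp : IsStarProjection p) : (offDiagonal p).ClosedComplemented := by
  have hpp : p * p = p := hp.isIdempotentElem
  have hps : star p = p := hp.isSelfAdjoint
  have hp' (z : A) : p * (p * z) = p * z := by rw [← mul_assoc, hpp]
  set τ : A →L[ℝ] A := (ContinuousLinearMap.mulLeftRight ℝ A p (1 - p) +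
    ContinuousLinearMap.mulLeftRight ℝ A (1 - p) p) ∘L
      ((1 / 2 : ℝ) • (ContinuousLinearMap.id ℝ A + (starL' ℝ : A ≃L[ℝ] A).toContinuousLinearMap))
    with hτ
  have hval (x : A) : τ x = p * ((1 / 2 : ℝ) • (x + star x)) * (1 - p) +
      (1 - p) * ((1 / 2 : ℝ) • (x + star x)) * p := rfl
  have hmem (x : A) : τ x ∈ offDiagonal p := by
    rw [mem_offDiagonal, hval]
    refine ⟨?_, ?_, ?_⟩
    · simp only [mul_sub, sub_mul, mul_add, add_mul, one_mul, mul_one, mul_assoc, hpp, hp']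
      abel
    · simp only [mul_sub, sub_mul, mul_add, add_mul, one_mul, mul_one, mul_assoc, hpp, hp']
      abel
    · simp only [star_add, star_mul, star_sub, star_one, hps, star_smul, star_star, star_trivial]
      rw [add_comm (star x) x]
      noncomm_ring
  refine ⟨τ.codRestrict _ hmem, ?_⟩
  rintro ⟨x, h1, h2, h3⟩
  apply Subtype.ext
  change τ x = x
  rw [hval, h3, ← two_smul ℝ x, smul_smul]
  norm_num
  have : x = p * x * (1 - p) + (1 - p) * x * p + p * x * p + (1 - p) * x * (1 - p) := by
    noncomm_ring
  rw [h1, h2, add_zero, add_zero] at this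
  exact this.symm

set_option linter.unusedSimpArgs false in
/-- Near `p`, the map `projectionChart p` straightens the manifold of projections. -/
theorem projectionChart_mem_iff [StarRing A] [NormedStarGroup A] [StarModule ℝ A] {p x : A}
    (hp : IsStarProjection p) (h1 : ‖p * (x - p) * p‖ < 1 / 2)
    (h2 : ‖(1 - p) * (x - p) * (1 - p)‖ < 1 / 2) :
    projectionChart p x ∈ offDiagonal p ↔ IsStarProjection x := by
  have hpp : p * p = p := hp.isIdempotentElem
  have hps : star p = p := hp.isSelfAdjoint
  obtain ⟨q, hq⟩ : ∃ q, q = 1 - p := ⟨_, rfl⟩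
  rw [← hq] at h2
  have hpq : p + q = 1 := by rw [hq]; abel
  have hqq : q * q = q := by rw [hq]; simp [mul_sub, sub_mul, hpp]
  have hqs : star q = q := by rw [hq]; simp [hps]
  have hpq0 : p * q = 0 := by rw [hq, mul_sub, hpp]; simp
  have hqp0 : q * p = 0 := by rw [hq, sub_mul, hpp]; simp
  have hp' (z : A) : p * (p * z) = p * z := by rw [← mul_assoc, hpp]
  have hq' (z : A) : q * (q * z) = q * z := by rw [← mul_assoc, hqq]
  have hpq' (z : A) : p * (q * z) = 0 := by rw [← mul_assoc, hpq0, zero_mul]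
  have hqp' (z : A) : q * (p * z) = 0 := by rw [← mul_assoc, hqp0, zero_mul]
  have hdef : projectionChart p x = p * x * q + q * x * p + p * (x * x - x) * p +
    q * (x * x - x) * q := by rw [hq]; rfl
  generalize hy : x * x - x = y at hdef
  rw [mem_offDiagonal, ← hq, hdef]
  have c1 : p * (p * x * q + q * x * p + p * y * p + q * y * q) * p = p * y * p := by
    simp only [mul_add, add_mul, mul_assoc, hpp, hqq, hpq0, hqp0, hp', hq', hpq', hqp', mul_zero,
      zero_add, add_zero]
  have c2 : q * (p * x * q + q * x * p + p * y * p + q * y * q) * q = q * y * q := by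
    simp only [mul_add, add_mul, mul_assoc, hpp, hqq, hpq0, hqp0, hp', hq', hpq', hqp', mul_zero,
      zero_add, add_zero]
  rw [c1, c2]
  have hdecomp (z : A) : z = p * z * p + q * z * q + p * z * q + q * z * p := by
    have : z = (p + q) * z * (p + q) := by rw [hpq, one_mul, mul_one]
    nth_rw 1 [this]
    noncomm_ring
  constructor
  · rintro ⟨hy1, hy2, hs⟩
    have hcomm : x * y = y * x := by rw [← hy]; noncomm_ring
    obtain ⟨hy3, hy4⟩ := corner_eq_zero hpp hqq hpq hcomm hy1 hy2 h1 h2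
    have hy0 : y = 0 := by rw [hdecomp y, hy1, hy2, hy3, hy4]; simp
    have hxx : x * x = x := by rw [← sub_eq_zero, hy, hy0]
    simp only [hy0, mul_zero, zero_mul, add_zero] at hs
    have hoff : star (q * x * p) = p * x * q := by
      have h3 := congrArg (fun z => p * z * q) hs
      simp only [star_add, star_mul, hps, hqs, mul_add, add_mul, mul_assoc, hpp, hqq, hpq0, hqp0,
        hp', hq', hpq', hqp', mul_zero, zero_add, add_zero] at h3
      simpa [star_mul, hps, hqs, mul_assoc] using h3
    have hoff' : star (p * x * q) = q * x * p := by rw [← hoff, star_star]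
    -- A diagonal block of `x = x * x`. The two failure alternatives stand in for idempotency
    -- hypotheses, so that the identity can be used for both `(p, q)` and `(q, p)`.
    have hdiag (e f : A) (hef : e + f = 1) : e * x * e = (e * x * e) * (e * x * e) +
        (e * x * f) * (f * x * e) ∨ e * e ≠ e ∨ f * f ≠ f := by
      by_cases hee : e * e = e
      · by_cases hff : f * f = f
        · left
          have h4 : e * (x * x) * e = e * x * (e + f) * x * e := by rw [hef]; noncomm_ring
          have h5 : e * x * e * (e * x * e) = e * x * e * x * e := by
            rw [mul_assoc (e * x) e, ← mul_assoc e (e * x), ← mul_assoc e e, hee]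
            noncomm_ring
          have h6 : e * x * f * (f * x * e) = e * x * f * x * e := by
            rw [mul_assoc (e * x) f, ← mul_assoc f (f * x), ← mul_assoc f f, hff]
            noncomm_ring
          rw [h5, h6]
          nth_rw 1 [← hxx]
          rw [h4]
          noncomm_ring
        · exact Or.inr (Or.inr hff)
      · exact Or.inr (Or.inl hee)
    have small (z s t : A) (c : ℝ) (hc : c < 1 / 2) (hz : z = s + t) (hs : ‖s‖ ≤ c * ‖z‖)
        (ht : ‖t‖ ≤ c * ‖z‖) : z = 0 := by
      have h3 : ‖z‖ ≤ c * ‖z‖ + c * ‖z‖ := by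
        nth_rw 1 [hz]
        exact (norm_add_le s t).trans (add_le_add hs ht)
      by_contra hne
      have hpos := norm_pos_iff.mpr hne
      nlinarith
    -- With `p * x * p = p + a` and `b = (p * x * q) * (q * x * p)`, which is self-adjoint by
    -- `hoff`, both `a` and `star a` solve `t = 2t + t ^ 2 + b`. Subtracting gives `a - star a = -(a
    -- * (a - star a)) - (a - star a) * star a`, and `‖a‖ < 1 / 2` forces equality. The block at `q`
    -- works likewise with `t = t ^ 2 + b`.
    have hA : p * x * p = star (p * x * p) := by
      have h3 := (hdiag p q hpq).resolve_right (by simp [hpp, hqq])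
      have h4 := congrArg star h3
      rw [star_add, star_mul (p * x * p) (p * x * p), star_mul (p * x * q), hoff, hoff'] at h4
      obtain ⟨a, ha⟩ : ∃ a, a = p * (x - p) * p := ⟨_, rfl⟩
      rw [← ha] at h1
      have h5 : p * x * p = p + a := by
        rw [ha, mul_sub, sub_mul, hpp, hpp]; abel
      have hpa : p * a = a := by rw [ha, ← mul_assoc, ← mul_assoc, hpp]
      have hap : a * p = a := by rw [ha, mul_assoc, hpp]
      have hpa' : star a * p = star a := by
        simpa [hps] using congrArg star hpa
      have hap' : p * star a = star a := by
        simpa [hps] using congrArg star hap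
      rw [h5] at h3 h4 ⊢
      rw [star_add, hps] at h4 ⊢
      rw [add_right_inj, ← sub_eq_zero]
      generalize p * x * q * (q * x * p) = b at h3 h4
      have h6 : a = a + a + a * a + b := by
        have : p + a = p + (a + a + a * a + b) := by
          nth_rw 1 [h3]
          simp only [mul_add, add_mul, hpp, hpa, hap]
          abel
        exact add_left_cancel this
      have h7 : star a = star a + star a + star a * star a + b := by
        have : p + star a = p + (star a + star a + star a * star a + b) := by
          nth_rw 1 [h4]
          simp only [mul_add, add_mul, hpp, hpa', hap']
          abel
        exact add_left_cancel this
      refine small _ (-(a * (a - star a))) (-((a - star a) * star a)) ‖a‖ h1 ?_ ?_ ?_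
      · have h8 : a * a = -a - b := by
          have := sub_eq_zero.mpr h6
          rw [← sub_eq_zero]
          rw [← neg_eq_zero, ← this]
          abel
        have h9 : star a * star a = -star a - b := by
          have := sub_eq_zero.mpr h7
          rw [← sub_eq_zero]
          rw [← neg_eq_zero, ← this]
          abel
        simp only [mul_sub, sub_mul, h8, h9]
        abel
      · rw [norm_neg]
        exact norm_mul_le _ _
      · rw [norm_neg, mul_comm ‖a‖]
        exact (norm_mul_le _ _).trans_eq (by rw [norm_star])
    have hD : q * x * q = star (q * x * q) := by
      have h3 := (hdiag q p (by rw [add_comm, hpq])).resolve_right (by simp [hpp, hqq])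
      have h4 := congrArg star h3
      rw [star_add, star_mul (q * x * q) (q * x * q), star_mul (q * x * p), hoff, hoff'] at h4
      have h5 : q * (x - p) * q = q * x * q := by
        rw [mul_sub, sub_mul, hqp0, zero_mul, sub_zero]
      rw [h5] at h2
      generalize q * x * q = d at *
      generalize q * x * p * (p * x * q) = b at h3 h4
      rw [← sub_eq_zero]
      refine small _ (d * (d - star d)) ((d - star d) * star d) ‖d‖ h2 ?_ ?_ ?_
      · have h8 : d * d = d - b := eq_sub_of_add_eq h3.symm
        have h9 : star d * star d = star d - b := eq_sub_of_add_eq h4.symm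
        simp only [mul_sub, sub_mul, h8, h9]
        abel
      · exact norm_mul_le _ _
      · rw [mul_comm ‖d‖]
        exact (norm_mul_le _ _).trans_eq (by rw [norm_star])
    refine ⟨hxx, ?_⟩
    change star x = x
    rw [hdecomp x, star_add, star_add, star_add, ← hA, ← hD, hoff, hoff']
    abel
  · intro hx
    have hxx : x * x = x := hx.isIdempotentElem
    have hxs : star x = x := hx.isSelfAdjoint
    have hy0 : y = 0 := by rw [← hy, hxx, sub_self]
    subst hy0
    simp only [mul_zero, zero_mul, add_zero, true_and, star_add, star_mul, hps, hqs, hxs]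
    rw [← mul_assoc, ← mul_assoc, add_comm]

end GrassmannianChart

/-! ### Weakly holomorphic maps into a Hilbert space -/

section WeaklyHolomorphic

variable {H : Type*} [NormedAddCommGroup H] [InnerProductSpace ℂ H] [CompleteSpace H]

/-- A weakly holomorphic function is locally Lipschitz. -/
theorem exists_lipschitzOnWith_of_weakly_differentiableOn {G : ℂ → H} {c : ℂ} {r : ℝ} (hr : 0 < r)
    (hG : ∀ f : H, DifferentiableOn ℂ (fun z => inner ℂ f (G z)) (Metric.ball c (3 * r))) :
    ∃ K, LipschitzOnWith K G (Metric.closedBall c r) := by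
  have hcont (f : H) : ContinuousOn (fun z => inner ℂ f (G z)) (Metric.closedBall c (2 * r)) :=
    (hG f).continuousOn.mono (Metric.closedBall_subset_ball (by linarith))
  -- Each scalar function is bounded on the compact disc of radius `2 * r`; uniform boundedness
  -- yields one bound for `‖G‖`. The room between the radii `r` and `2 * r` serves Cauchy's
  -- estimate.
  obtain ⟨C, hC⟩ := banach_steinhaus
    (g := fun z : Metric.closedBall c (2 * r) => innerSL ℂ (G z)) fun f => by
      obtain ⟨C, hC⟩ := (isCompact_closedBall c (2 * r)).exists_bound_of_continuousOn (hcont f)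
      refine ⟨C, fun z => ?_⟩
      rw [innerSL_apply_apply, norm_inner_symm]
      exact hC z z.2
  have hCG : ∀ z ∈ Metric.closedBall c (2 * r), ‖G z‖ ≤ C := fun z hz => by
    simpa using hC ⟨z, hz⟩
  have hC0 : 0 ≤ C := (norm_nonneg _).trans (hCG c (by simp; positivity))
  refine ⟨⟨C / r, by positivity⟩, LipschitzOnWith.of_dist_le_mul fun z hz w hw => ?_⟩
  rw [dist_eq_norm, dist_eq_norm]
  have key (f : H) : ‖inner ℂ f (G z) - inner ℂ f (G w)‖ ≤ ‖f‖ * C / r * ‖z - w‖ := by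
    refine Convex.norm_image_sub_le_of_norm_deriv_le (f := fun z => inner ℂ f (G z))
      (s := Metric.closedBall c r) (fun x hx => ?_) (fun x hx => ?_) (convex_closedBall c r) hw hz
    · exact (hG f).differentiableAt (Metric.isOpen_ball.mem_nhds
        (Metric.closedBall_subset_ball (by linarith) hx))
    · have hsub : Metric.closedBall x r ⊆ Metric.closedBall c (2 * r) :=
        Metric.closedBall_subset_closedBall' (by
          have := Metric.mem_closedBall.mp hx
          linarith)
      refine Complex.norm_deriv_le_of_forall_mem_sphere_norm_le hr ?_ fun y hy => ?_
      · refine DifferentiableOn.diffContOnCl ((hG f).mono ?_)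
        rw [closure_ball x hr.ne']
        exact hsub.trans (Metric.closedBall_subset_ball (by linarith))
      · exact (norm_inner_le_norm _ _).trans (mul_le_mul_of_nonneg_left
          (hCG y (hsub (Metric.sphere_subset_closedBall hy))) (norm_nonneg _))
  -- Testing against the difference itself turns the weak estimate into a norm estimate.
  have h1 := key (G z - G w)
  rw [← inner_sub_right, inner_self_eq_norm_sq_to_K] at h1
  simp only [Complex.coe_algebraMap, norm_pow, Complex.norm_real, norm_norm] at h1
  rcases (norm_nonneg (G z - G w)).eq_or_lt with h0 | h0
  · rw [← h0]
    change 0 ≤ C / r * ‖z - w‖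
    positivity
  · change _ ≤ C / r * ‖z - w‖
    refine le_of_mul_le_mul_left ?_ h0
    calc _ = ‖G z - G w‖ ^ 2 := by ring
      _ ≤ _ := h1
      _ = _ := by ring

/-- A weakly holomorphic function with values in a Hilbert space is holomorphic. -/
theorem differentiableOn_of_weakly_differentiableOn {G : ℂ → H} {U : Set ℂ} (hU : IsOpen U)
    (hG : ∀ f : H, DifferentiableOn ℂ (fun z => inner ℂ f (G z)) U) : DifferentiableOn ℂ G U := by
  intro c hc
  obtain ⟨ε, hε, hεU⟩ := Metric.isOpen_iff.mp hU c hc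
  have hr : 0 < ε / 3 := by positivity
  obtain ⟨K, hK⟩ := exists_lipschitzOnWith_of_weakly_differentiableOn (G := G) hr fun f =>
    (hG f).mono (by rwa [mul_div_cancel₀ _ (by norm_num)])
  generalize hrdef : ε / 3 = r at *
  have hint : CircleIntegrable G c r :=
    (hK.continuousOn.mono Metric.sphere_subset_closedBall).circleIntegrable hr.le
  -- The Lipschitz bound gives the continuity needed to form the Cauchy integral of `G`, which is
  -- holomorphic as the sum of a power series.
  have hps := hasFPowerSeriesOn_cauchy_integral (R := ⟨r, hr.le⟩) hint hr
  have hd := hps.hasFPowerSeriesAt.differentiableAt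
  refine (hd.congr_of_eventuallyEq ?_).differentiableWithinAt
  filter_upwards [Metric.ball_mem_nhds c hr] with w hw
  -- The integral agrees with `G` because, after pairing with any `f`, this is the scalar Cauchy
  -- formula.
  refine ext_inner_left ℂ fun f => ?_
  have hcl : DiffContOnCl ℂ (fun z => inner ℂ f (G z)) (Metric.ball c r) := by
    refine DifferentiableOn.diffContOnCl ((hG f).mono ?_)
    rw [closure_ball c hr.ne']
    exact (Metric.closedBall_subset_ball (by linarith)).trans hεU
  rw [← hcl.two_pi_i_inv_smul_circleIntegral_sub_inv_smul hw, inner_smul_right, smul_eq_mul]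
  congr 1
  have hint' : CircleIntegrable (fun z => (z - w)⁻¹ • G z) c r := by
    refine ContinuousOn.circleIntegrable hr.le (ContinuousOn.smul ?_
      (hK.continuousOn.mono Metric.sphere_subset_closedBall))
    refine ContinuousOn.inv₀ (by fun_prop) fun z hz => sub_ne_zero.mpr ?_
    rintro rfl
    exact absurd (Metric.mem_sphere.mp hz) (Metric.mem_ball.mp hw).ne
  have h := (innerSL ℂ f).intervalIntegral_comp_comm hint'.out
  simp only [innerSL_apply_apply] at h
  change _ = inner ℂ f (∮ z in C(c, r), (z - w)⁻¹ • G z)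
  rw [circleIntegral, circleIntegral, ← h]
  simp only [inner_smul_right, smul_eq_mul]

/-- Only real bilinearity is available, since the second argument enters conjugate-linearly; this
suffices for real smoothness. -/
theorem isBoundedBilinearMap_rankOne :
    IsBoundedBilinearMap ℝ fun p : H × H => InnerProductSpace.rankOne ℂ p.1 p.2 where
  add_left x y z := by simp
  smul_left c x y := by
    ext z
    simp only [InnerProductSpace.rankOne_apply, smul_apply]
    exact smul_comm _ _ _
  add_right x y z := by simp
  smul_right c x y := by
    ext z
    simp only [InnerProductSpace.rankOne_apply, smul_apply]
    rw [← Complex.coe_smul c y, inner_smul_left, mul_smul]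
    simp
  bound := ⟨1, one_pos, fun x y => by simp⟩

end WeaklyHolomorphic

/-! ### The reproducing kernel and the projections onto the zero spaces -/

section Kernel

variable (H : Type*) [NormedAddCommGroup H] [InnerProductSpace ℂ H] [CompleteSpace H]
  [RKHS ℂ H 𝔻 ℂ]

variable {H} in
theorem inner_kernelAt_left (a : 𝔻) (f : H) : inner ℂ (kernelAt H a) f = f a := by
  simp [kernelAt]

variable {H} in
theorem inner_kernelAt_right (a : 𝔻) (f : H) : inner ℂ f (kernelAt H a) = conj (f a) := by
  rw [← inner_conj_symm, inner_kernelAt_left]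

open Classical in
/-- The kernel `z ↦ k_z`, extended by zero to the complex plane. -/
noncomputable def kernelExt (z : ℂ) : H :=
  if h : ‖z‖ < 1 then kernelAt H (Complex.UnitDisc.mk z h) else 0

theorem kernelExt_coe (a : 𝔻) : kernelExt H a = kernelAt H a := by
  rw [kernelExt, dif_pos a.norm_lt_one]
  rfl

theorem exists_unitDisc_coe {z : ℂ} (hz : z ∈ Metric.ball (0 : ℂ) 1) : ∃ a : 𝔻, (a : ℂ) = z :=
  ⟨Complex.UnitDisc.mk z (by simpa using hz), rfl⟩

theorem coe_mem_ball (a : 𝔻) : (a : ℂ) ∈ Metric.ball (0 : ℂ) 1 := by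
  simpa using a.norm_lt_one

variable {H}

theorem differentiableOn_inner_kernelExt (h : ConsistsOfAnalytic H) (f : H) :
    DifferentiableOn ℂ (fun z => inner ℂ (kernelExt H z) f) (Metric.ball 0 1) := by
  obtain ⟨F, hF, hfF⟩ := h f
  refine hF.differentiableOn.congr fun z hz => ?_
  obtain ⟨a, rfl⟩ := exists_unitDisc_coe hz
  rw [kernelExt_coe, inner_kernelAt_left, hfF]

/-- The kernel is antiholomorphic. -/
theorem differentiableOn_kernelExt_conj (h : ConsistsOfAnalytic H) :
    DifferentiableOn ℂ (fun z => kernelExt H (conj z)) (Metric.ball 0 1) := by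
  refine differentiableOn_of_weakly_differentiableOn Metric.isOpen_ball fun f => ?_
  intro z hz
  have hz' : conj z ∈ Metric.ball (0 : ℂ) 1 := by simpa using hz
  have h1 := (differentiableOn_inner_kernelExt h f).differentiableAt
    (Metric.isOpen_ball.mem_nhds hz')
  have h2 := h1.conj_conj
  rw [Complex.conj_conj] at h2
  refine (h2.congr_of_eventuallyEq (Filter.Eventually.of_forall fun w => ?_)).differentiableWithinAt
  simp [inner_conj_symm]

/-- The kernel is a holomorphic map precomposed with conjugation, which is real-linear. -/
theorem contDiffOn_kernelExt (h : ConsistsOfAnalytic H) :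
    ContDiffOn ℝ ∞ (kernelExt H) (Metric.ball 0 1) := by
  have h1 : ContDiffOn ℝ ∞ (fun z => kernelExt H (conj z)) (Metric.ball 0 1) :=
    ((differentiableOn_kernelExt_conj h).contDiffOn Metric.isOpen_ball).restrict_scalars ℝ
  have h2 := h1.comp (s := Metric.ball 0 1) Complex.conjCLE.contDiff.contDiffOn
    (fun z hz => by simpa using hz)
  refine h2.congr fun z _ => ?_
  simp

variable (H) in
/-- The projection onto the functions which vanish at `z`. -/
noncomputable def zeroProjection (z : ℂ) : H →L[ℂ] H :=
  1 - (‖kernelExt H z‖ ^ 2)⁻¹ • InnerProductSpace.rankOne ℂ (kernelExt H z) (kernelExt H z)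

theorem contDiffOn_zeroProjection (h : ConsistsOfAnalytic H)
    (h0 : ∀ a : 𝔻, kernelAt H a ≠ 0) :
    ContDiffOn ℝ ∞ (zeroProjection H) (Metric.ball 0 1) := by
  have hk := contDiffOn_kernelExt h
  have h1 : ContDiffOn ℝ ∞ (fun z => InnerProductSpace.rankOne ℂ (kernelExt H z) (kernelExt H z))
      (Metric.ball 0 1) := by
    have hb := (isBoundedBilinearMap_rankOne (H := H)).contDiff (n := ∞)
    exact hb.comp_contDiffOn (hk.prodMk hk)
  have h2 : ContDiffOn ℝ ∞ (fun z => (‖kernelExt H z‖ ^ 2)⁻¹) (Metric.ball 0 1) := by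
    refine (hk.norm_sq ℂ).inv fun z hz => ?_
    obtain ⟨a, rfl⟩ := exists_unitDisc_coe hz
    rw [kernelExt_coe]
    exact pow_ne_zero _ (norm_ne_zero_iff.mpr (h0 a))
  exact contDiffOn_const.sub (h2.smul h1)

theorem zeroProjection_apply (a : 𝔻) (f : H) : zeroProjection H a f =
    f - (‖kernelAt H a‖ ^ 2)⁻¹ • f a • kernelAt H a := by
  simp [zeroProjection, kernelExt_coe, inner_kernelAt_left]

omit [CompleteSpace H] in
theorem mem_zeroSpace {a : 𝔻} {f : H} : f ∈ zeroSpace H a ↔ f a = 0 := Iff.rfl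

theorem kernelAt_apply_self (a : 𝔻) : kernelAt H a a = (‖kernelAt H a‖ : ℂ) ^ 2 := by
  rw [← inner_kernelAt_left, inner_self_eq_norm_sq_to_K]
  rfl

/-- The difference `f - P_a f` is a multiple of `k_a`, and `k_a` is orthogonal to every function
vanishing at `a` by the reproducing property. -/
theorem projOnto_zeroSpace {a : 𝔻} (h0 : kernelAt H a ≠ 0) :
    projOnto (zeroSpace H a) = zeroProjection H a := by
  ext1 f
  refine Submodule.eq_starProjection_of_mem_orthogonal ?_ ?_
  · refine Submodule.le_topologicalClosure _ ?_
    rw [mem_zeroSpace, zeroProjection_apply]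
    have h1 : (‖kernelAt H a‖ : ℂ) ≠ 0 := by simpa using h0
    rw [← Complex.coe_smul, smul_smul]
    simp [kernelAt_apply_self]
    field_simp
    simp
  · rw [Submodule.orthogonal_closure, zeroProjection_apply, sub_sub_cancel, ← Complex.coe_smul]
    refine Submodule.smul_mem _ _ (Submodule.smul_mem _ _ ?_)
    intro g hg
    rw [inner_kernelAt_right, mem_zeroSpace.mp hg, map_zero]

theorem zeroSpaces_eq (h0 : ∀ a : 𝔻, kernelAt H a ≠ 0) :
    zeroSpaces H = zeroProjection H '' Metric.ball 0 1 := by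
  ext P
  constructor
  · rintro ⟨a, rfl⟩
    exact ⟨a, coe_mem_ball a, (projOnto_zeroSpace (h0 a)).symm⟩
  · rintro ⟨z, hz, rfl⟩
    obtain ⟨a, rfl⟩ := exists_unitDisc_coe hz
    exact ⟨a, projOnto_zeroSpace (h0 a)⟩

theorem zeroProjection_mem_grassmannian {a : 𝔻} (h0 : kernelAt H a ≠ 0) :
    zeroProjection H a ∈ grassmannian H := by
  rw [← projOnto_zeroSpace h0]
  exact isStarProjection_starProjection

omit [CompleteSpace H] in
theorem isClosed_zeroSpace (a : 𝔻) : IsClosed (zeroSpace H a : Set H) :=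
  isClosed_singleton.preimage (RKHS.continuous_eval (H := H) a)

theorem range_zeroProjection {a : 𝔻} (h0 : kernelAt H a ≠ 0) :
    (zeroProjection H a).range = zeroSpace H a := by
  rw [← projOnto_zeroSpace h0]
  refine (Submodule.range_starProjection _).trans ?_
  exact (isClosed_zeroSpace a).submodule_topologicalClosure_eq

end Kernel

/-- An injective linear map on a finite-dimensional space has a continuous left inverse. -/
theorem hasLeftInverse_of_injective {V E : Type*} [NormedAddCommGroup V] [NormedSpace ℝ V]
    [FiniteDimensional ℝ V] [NormedAddCommGroup E] [NormedSpace ℝ E] {D : V →L[ℝ] E}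
    (hD : Function.Injective D) : D.HasLeftInverse := by
  obtain ⟨f, hf⟩ := Submodule.ClosedComplemented.of_finiteDimensional (𝕜 := ℝ) D.range
  let e : V ≃ₗ[ℝ] D.range := LinearEquiv.ofInjective (D : V →ₗ[ℝ] E) hD
  refine ⟨(e.symm : D.range →ₗ[ℝ] V).toContinuousLinearMap ∘L f, fun v => ?_⟩
  change e.symm (f (D v)) = v
  rw [LinearEquiv.symm_apply_eq]
  exact hf (e v)

/-! ### Transitivity on the disc -/

section Moebius

theorem moebiusPerm_apply_zero (a : 𝔻) : moebiusPerm a 1 0 = a := by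
  ext
  simp [coe_moebiusPerm]

theorem exists_moebius_apply_eq (a b : 𝔻) : ∃ φ : moebiusGroup, φ.1 a = b := by
  refine ⟨⟨moebiusPerm b 1, b, 1, rfl⟩ * ⟨moebiusPerm a 1, a, 1, rfl⟩⁻¹, ?_⟩
  change moebiusPerm b 1 ((moebiusPerm a 1)⁻¹ a) = b
  rw [Equiv.Perm.inv_eq_iff_eq.mpr (moebiusPerm_apply_zero a).symm, moebiusPerm_apply_zero]

end Moebius

/-! ### Equivariance, injectivity and the immersion property -/

section Immersion

variable {H : Type*} [NormedAddCommGroup H] [InnerProductSpace ℂ H] [CompleteSpace H]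
  [RKHS ℂ H 𝔻 ℂ]

-- A translate of `f` takes at `φ(a)` the value `f a`. For the reverse inclusion, the preimage of
-- `g` is `g ∘ φ`, which lies in `H` by the action of `φ⁻¹`.
omit [CompleteSpace H] in
theorem translate_zeroSpace (h : MoebiusActs H) (φ : moebiusGroup) (a : 𝔻) :
    translate φ (zeroSpace H a) = zeroSpace H (φ.1 a) := by
  ext g
  constructor
  · rintro ⟨f, hf, hg⟩
    rw [mem_zeroSpace, hg]
    change f (φ.1.symm (φ.1 a)) = 0
    rw [Equiv.symm_apply_apply]
    exact hf
  · intro hg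
    obtain ⟨f, hf⟩ := h φ⁻¹ g
    rw [inv_inv] at hf
    refine ⟨f, ?_, fun z => ?_⟩
    · rw [mem_zeroSpace, hf]
      exact hg
    · rw [hf]
      change g z = g (φ.1 (φ.1.symm z))
      rw [Equiv.apply_symm_apply]

theorem zeroProjection_kernelAt {a : 𝔻} (h0 : kernelAt H a ≠ 0) :
    zeroProjection H a (kernelAt H a) = 0 := by
  have h1 : (‖kernelAt H a‖ : ℂ) ≠ 0 := by simpa using h0
  rw [zeroProjection_apply, kernelAt_apply_self, ← Complex.coe_smul, smul_smul]
  simp [h1]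

/-- If `P_a = P_b`, then `P_a` kills `k_b`, so `k_b` is a multiple of `k_a`. -/
theorem injective_zeroProjection (h0 : ∀ a : 𝔻, kernelAt H a ≠ 0)
    (hi : ∀ a b : 𝔻, a ≠ b → LinearIndependent ℂ ![kernelAt H a, kernelAt H b]) :
    Function.Injective fun a : 𝔻 => zeroProjection H a := by
  intro a b hab
  by_contra hne
  have h1 := zeroProjection_kernelAt (h0 b)
  rw [← show zeroProjection H a = zeroProjection H b from hab, zeroProjection_apply,
    ← Complex.coe_smul, smul_smul] at h1
  generalize (((‖kernelAt H a‖ ^ 2)⁻¹ : ℝ) : ℂ) * kernelAt H b a = c at h1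
  have h2 := LinearIndependent.pair_iff.mp (hi a b hne) (-c) 1 (by
    rw [neg_smul, one_smul, neg_add_eq_sub, h1])
  exact one_ne_zero h2.2

/-- Where the derivative of `z ↦ Z_z` vanishes in some direction, the functions of `H` with a zero
have a double zero. -/
theorem deriv_eq_zero_of_fderiv_zeroProjection (hA : ConsistsOfAnalytic H)
    (h0 : ∀ a : 𝔻, kernelAt H a ≠ 0) {a : 𝔻} {w : ℂ} (hw : w ≠ 0)
    (hd : fderiv ℝ (zeroProjection H) a w = 0) {f : H} (hf : f a = 0) :
    deriv (fun z => inner ℂ (kernelExt H z) f) a = 0 := by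
  have hball := Metric.isOpen_ball.mem_nhds (coe_mem_ball a)
  have hF := (((contDiffOn_zeroProjection hA h0).contDiffAt hball).differentiableAt
    (by simp)).hasFDerivAt
  have hK := (((contDiffOn_kernelExt hA).contDiffAt hball).differentiableAt
    (by simp)).hasFDerivAt
  have hF' := (ContinuousLinearMap.restrictScalarsL ℂ H H ℝ ℝ).hasFDerivAt.comp (a : ℂ) hF
  -- Differentiate the identity `P_z k_z = 0` in the direction `w`: as the derivative of `P`
  -- vanishes there, `P_a` kills the derivative of the kernel, which is therefore a multiple of
  -- `k_a`.
  have h1 := hF'.clm_apply hK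
  have h2 := (hasFDerivAt_const (𝕜 := ℝ) (0 : H) (a : ℂ)).congr_of_eventuallyEq (f₁ := fun z =>
      ((ContinuousLinearMap.restrictScalarsL ℂ H H ℝ ℝ) ∘ zeroProjection H) z (kernelExt H z)) (by
    filter_upwards [hball] with z hz
    obtain ⟨b, rfl⟩ := exists_unitDisc_coe hz
    rw [kernelExt_coe]
    exact zeroProjection_kernelAt (h0 b))
  have h3 := congrArg (fun L : ℂ →L[ℝ] H => L w) (h1.unique h2)
  have h4 : zeroProjection H a (fderiv ℝ (kernelExt H) a w) +
      (fderiv ℝ (zeroProjection H) a w) (kernelExt H a) = 0 := h3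
  rw [hd, zero_apply, add_zero, zeroProjection_apply, sub_eq_zero,
    ← Complex.coe_smul, smul_smul] at h4
  -- The pairing is holomorphic in `z`, so its real derivative along `w` is the complex derivative
  -- times `w`; vanishing in one direction is enough.
  have h5 : HasFDerivAt (fun z => inner ℂ (kernelExt H z) f)
      ((deriv (fun z => inner ℂ (kernelExt H z) f) a) • (1 : ℂ →L[ℂ] ℂ) |>.restrictScalars ℝ)
      (a : ℂ) := by
    have := ((differentiableOn_inner_kernelExt hA f).differentiableAt hball).hasDerivAt
    exact this.complexToReal_fderiv
  have h6 := hK.inner ℂ (hasFDerivAt_const f (a : ℂ))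
  have h7 := congrArg (fun L : ℂ →L[ℝ] ℂ => L w) (h5.unique h6)
  have h8 : deriv (fun z => inner ℂ (kernelExt H z) f) a * w =
      inner ℂ (fderiv ℝ (kernelExt H) a w) f := by
    simpa [fderivInnerCLM_apply] using h7
  rw [h4, inner_smul_left, inner_kernelAt_left, hf, mul_zero] at h8
  exact (mul_eq_zero.mp h8).resolve_right hw

/-- Write `f = g ∘ φ` with `φ(b) = a` and `g` in `H`; the chain rule carries the double zero of `g`
at `a` to `b`. -/
theorem deriv_eq_zero_of_moebius (hA : ConsistsOfAnalytic H) (hM : MoebiusActs H) {a : 𝔻}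
    (h : ∀ f : H, f a = 0 → deriv (fun z => inner ℂ (kernelExt H z) f) a = 0) (b : 𝔻) {f : H}
    (hf : f b = 0) : deriv (fun z => inner ℂ (kernelExt H z) f) b = 0 := by
  obtain ⟨φ, hφ⟩ := exists_moebius_apply_eq b a
  obtain ⟨g, hg⟩ := hM φ f
  have hfg (z : 𝔻) : f z = g (φ.1 z) := by
    rw [hg]
    change f z = f (φ.1.symm (φ.1 z))
    rw [Equiv.symm_apply_apply]
  have hga : g a = 0 := by rw [← hφ, ← hfg, hf]
  obtain ⟨c, w, hcw⟩ := φ.2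
  set m : ℂ → ℂ := fun z => w * ((c - z) / (1 - conj (c : ℂ) * z)) with hm
  have hmφ (z : 𝔻) : m z = φ.1 z := by rw [hcw, coe_moebiusPerm]
  have hmd : DifferentiableAt ℂ m b := by
    have := moebius_den_ne_zero c b
    fun_prop (disch := assumption)
  have h1 : (fun z => inner ℂ (kernelExt H z) f) =ᶠ[𝓝 (b : ℂ)]
      (fun z => inner ℂ (kernelExt H z) g) ∘ m := by
    filter_upwards [Metric.isOpen_ball.mem_nhds (coe_mem_ball b)] with z hz
    obtain ⟨d, rfl⟩ := exists_unitDisc_coe hz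
    rw [Function.comp_apply, hmφ, kernelExt_coe, kernelExt_coe, inner_kernelAt_left,
      inner_kernelAt_left, hfg]
  have hmb : m b = a := by rw [hmφ, hφ]
  have hgd : HasDerivAt (fun z => inner ℂ (kernelExt H z) g) 0 (m b) := by
    rw [hmb, ← h g hga]
    exact ((differentiableOn_inner_kernelExt hA g).differentiableAt
      (Metric.isOpen_ball.mem_nhds (coe_mem_ball a))).hasDerivAt
  rw [h1.deriv_eq, (hgd.comp (b : ℂ) hmd.hasDerivAt).deriv, zero_mul]

/-- Otherwise every zero of every function is multiple. For all `f`, `g` this annihilates the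
Wronskian; with `g = k_0`, which is nonzero near `0`, each `f / g` is locally constant. Evaluation
at a nearby point `b` is then proportional to evaluation at `0`, against the independence of `k_b`
and `k_0`. -/
theorem exists_deriv_ne_zero (hA : ConsistsOfAnalytic H) (h0 : ∀ a : 𝔻, kernelAt H a ≠ 0)
    (hi : ∀ a b : 𝔻, a ≠ b → LinearIndependent ℂ ![kernelAt H a, kernelAt H b]) :
    ∃ (b : 𝔻) (f : H), f b = 0 ∧ deriv (fun z => inner ℂ (kernelExt H z) f) b ≠ 0 := by
  by_contra! hcon
  set e : H → ℂ → ℂ := fun f z => inner ℂ (kernelExt H z) f with he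
  have hed (f : H) : DifferentiableOn ℂ (e f) (Metric.ball 0 1) :=
    differentiableOn_inner_kernelExt hA f
  have heval (f : H) (a : 𝔻) : e f a = f a := by
    simp only [he]
    rw [kernelExt_coe, inner_kernelAt_left]
  set g : H := kernelAt H 0
  have hg0 : e g (0 : 𝔻) ≠ 0 := by
    rw [heval, kernelAt_apply_self]
    simpa using h0 0
  have hgnear : ∀ᶠ z in 𝓝 (0 : ℂ), e g z ≠ 0 :=
    ((hed g).continuousOn.continuousAt (Metric.ball_mem_nhds 0 one_pos)).eventually_ne hg0
  obtain ⟨r, hr, hrg⟩ := Metric.eventually_nhds_iff_ball.mp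
    (hgnear.and (Metric.ball_mem_nhds (0 : ℂ) one_pos))
  have hconst (f : H) {z : ℂ} (hz : z ∈ Metric.ball (0 : ℂ) r) :
      e f z / e g z = e f 0 / e g 0 := by
    refine Metric.isOpen_ball.is_const_of_deriv_eq_zero (s := Metric.ball (0 : ℂ) r)
      (f := fun z => e f z / e g z)
      (convex_ball 0 r).isPreconnected ?_ ?_ hz (Metric.mem_ball_self hr)
    · exact ((hed f).mono fun z hz => (hrg z hz).2).div ((hed g).mono fun z hz => (hrg z hz).2)
        fun z hz => (hrg z hz).1
    · intro z hz
      obtain ⟨hgz, hz1⟩ := hrg z hz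
      have hfd := (hed f).differentiableAt (Metric.isOpen_ball.mem_nhds hz1)
      have hgd := (hed g).differentiableAt (Metric.isOpen_ball.mem_nhds hz1)
      have h1 := hfd.hasDerivAt.div hgd.hasDerivAt hgz
      rw [Pi.zero_apply]
      refine h1.deriv.trans ?_
      obtain ⟨b, rfl⟩ := exists_unitDisc_coe hz1
      -- This combination vanishes at `b`, and its derivative there is the numerator of the
      -- derivative of the quotient `f / g`.
      have h2 := hcon b (g b • f - f b • g) (by simp [mul_comm])
      have h3 : e (g b • f - f b • g) = fun z => g b * e f z - f b * e g z := by
        funext z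
        simp [he]
      have h4 := (hfd.hasDerivAt.const_mul (g b)).sub (hgd.hasDerivAt.const_mul (f b))
      have h5 : deriv (e (g b • f - f b • g)) b = 0 := h2
      rw [h3] at h5
      replace h5 := h4.deriv.symm.trans h5
      rw [heval, heval, mul_comm (deriv (e f) _), h5, zero_div]
  have hz : ((r / 2 : ℝ) : ℂ) ∈ Metric.ball (0 : ℂ) r := by
    rw [mem_ball_zero_iff, Complex.norm_real, Real.norm_of_nonneg (by positivity)]
    linarith
  obtain ⟨b, hb⟩ := exists_unitDisc_coe (hrg _ hz).2
  have hgb : e g b ≠ 0 := by rw [hb]; exact (hrg _ hz).1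
  have hb0 : b ≠ 0 := by
    rintro rfl
    have : ((r / 2 : ℝ) : ℂ) = 0 := by rw [← hb]; simp
    rw [Complex.ofReal_eq_zero] at this
    linarith
  rw [← hb] at hz
  have hrel : conj (g 0) • kernelAt H b + (-conj (g b)) • kernelAt H 0 = 0 := by
    refine ext_inner_right ℂ fun f => ?_
    have h1 : e f b / e g b = e f (0 : 𝔻) / e g (0 : 𝔻) := by
      rw [Complex.UnitDisc.coe_zero]
      exact hconst f hz
    rw [div_eq_div_iff hgb hg0, heval, heval, heval, heval] at h1
    rw [inner_add_left, inner_smul_left, inner_smul_left, inner_kernelAt_left,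
      inner_kernelAt_left, inner_zero_left]
    simp only [map_neg, Complex.conj_conj]
    linear_combination h1
  have h2 := (LinearIndependent.pair_iff.mp (hi b 0 hb0) _ _ hrel).1
  rw [heval] at hg0
  exact hg0 (by simpa using h2)

/-- A nonzero kernel vector at one point yields double zeros at that point, hence at all points by
the Moebius action, which `exists_deriv_ne_zero` forbids. -/
theorem fderiv_zeroProjection_injective (hA : ConsistsOfAnalytic H)
    (h0 : ∀ a : 𝔻, kernelAt H a ≠ 0)
    (hi : ∀ a b : 𝔻, a ≠ b → LinearIndependent ℂ ![kernelAt H a, kernelAt H b])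
    (hM : MoebiusActs H) (a : 𝔻) : Function.Injective (fderiv ℝ (zeroProjection H) a) := by
  rw [injective_iff_map_eq_zero]
  intro w hw
  by_contra hne
  obtain ⟨b, f, hf, hd⟩ := exists_deriv_ne_zero hA h0 hi
  exact hd (deriv_eq_zero_of_moebius hA hM
    (fun g hg => deriv_eq_zero_of_fderiv_zeroProjection hA h0 hne hw hg) b hf)

end Immersion

/-! ### Closedness of the embedding and the submanifold statement -/

section Embedding

variable {H : Type*} [NormedAddCommGroup H] [InnerProductSpace ℂ H] [CompleteSpace H]
  [RKHS ℂ H 𝔻 ℂ]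

/-- For `k_a ≠ 0`, `1 - P_a` is the projection onto the line of `k_a`; this makes the quotient in
the boundary hypothesis an operator quantity. For `k_a = 0` both sides are zero by the convention
for division by zero. -/
theorem one_sub_zeroProjection_apply_kernelAt (a z : 𝔻) :
    ‖(1 - zeroProjection H a) (kernelAt H z)‖ =
      ‖kernelAt H a z / (‖kernelAt H a‖ : ℂ)‖ := by
  change ‖kernelAt H z - zeroProjection H a (kernelAt H z)‖ = _
  rw [zeroProjection_apply, sub_sub_cancel, norm_smul, norm_smul, norm_div]
  have h1 : ‖kernelAt H z a‖ = ‖kernelAt H a z‖ := by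
    rw [← inner_kernelAt_left, ← inner_kernelAt_left, norm_inner_symm]
  rw [h1]
  simp only [norm_inv, norm_pow, norm_norm, Complex.norm_real]
  rcases eq_or_ne ‖kernelAt H a‖ 0 with h | h
  · simp [h]
  · field_simp

theorem norm_one_sub_zeroProjection {a : 𝔻} (h0 : kernelAt H a ≠ 0) :
    ‖1 - zeroProjection H a‖ = 1 := by
  have h1 : ‖kernelAt H a‖ ≠ 0 := by simpa using h0
  rw [zeroProjection, sub_sub_cancel, kernelExt_coe, norm_smul, InnerProductSpace.norm_rankOne]
  simp only [norm_inv, norm_pow, norm_norm]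
  field_simp

/-- The boundary hypothesis keeps sequences of points with convergent zero spaces away from the
boundary. -/
theorem exists_subseq_tendsto (h0 : ∀ a : 𝔻, kernelAt H a ≠ 0)
    (hB : BoundaryHypothesis H (fun a : 𝔻 => (a : ℂ))) {b : ℕ → 𝔻} {P : H →L[ℂ] H}
    (hb : Filter.Tendsto (fun n => zeroProjection H (b n)) Filter.atTop (𝓝 P)) :
    ∃ (c : 𝔻) (s : ℕ → ℕ), StrictMono s ∧ Filter.Tendsto (b ∘ s) Filter.atTop (𝓝 c) := by
  obtain ⟨c, hc, s, hs, hlim⟩ := (isCompact_closedBall (0 : ℂ) 1).tendsto_subseq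
    (x := fun n => (b n : ℂ)) fun n => Metric.ball_subset_closedBall (coe_mem_ball (b n))
  rw [mem_closedBall_zero_iff] at hc
  rcases hc.lt_or_eq with hc | hc
  · refine ⟨Complex.UnitDisc.mk c hc, s, hs, ?_⟩
    rw [isOpenEmbedding_disc_coe.tendsto_nhds_iff]
    exact hlim
  exfalso
  have hrange : (c : OnePoint ℂ) ∉ Set.range fun a : 𝔻 => ((a : ℂ) : OnePoint ℂ) := by
    rintro ⟨a, ha⟩
    have h1 : (a : ℂ) = c := OnePoint.coe_injective ha
    have h2 := a.norm_lt_one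
    rw [h1] at h2
    exact h2.ne hc
  have hlim' : Filter.Tendsto (fun n => ((b (s n) : ℂ) : OnePoint ℂ)) Filter.atTop
      (𝓝 (c : OnePoint ℂ)) := (OnePoint.continuous_coe.tendsto c).comp hlim
  have hfr : (c : OnePoint ℂ) ∈ frontier (Set.range fun a : 𝔻 => ((a : ℂ) : OnePoint ℂ)) :=
    ⟨mem_closure_of_tendsto hlim' (Filter.Eventually.of_forall fun n => ⟨_, rfl⟩),
      fun h => hrange (interior_subset h)⟩
  have hzero := hB (b ∘ s) c ⟨hfr, hrange⟩ hlim'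
  have hQ := (hb.comp hs.tendsto_atTop).const_sub 1
  -- The boundary hypothesis says exactly that the projections `1 - P_{b_n}` tend to zero on each
  -- kernel along the subsequence.
  have hQk (z : 𝔻) : (1 - P) (kernelAt H z) = 0 := by
    have h1 : Filter.Tendsto (fun n => (1 - zeroProjection H (b (s n))) (kernelAt H z))
        Filter.atTop (𝓝 ((1 - P) (kernelAt H z))) :=
      ((ContinuousLinearMap.apply ℂ H (kernelAt H z)).continuous.tendsto _).comp hQ
    refine tendsto_nhds_unique h1 ?_
    rw [tendsto_zero_iff_norm_tendsto_zero]
    simp only [one_sub_zeroProjection_apply_kernelAt]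
    have h2 := (hzero z).norm
    rw [norm_zero] at h2
    exact h2
  -- The values of the adjoint applied to `f` are the pairings of `(1 - P) k_z` with `f`, all zero;
  -- so no separate density argument for the kernels is needed.
  have hP : ContinuousLinearMap.adjoint (1 - P) = 0 := by
    ext f z
    rw [← inner_kernelAt_left, ContinuousLinearMap.adjoint_inner_right, hQk]
    simp
  have hP' : 1 - P = 0 := by
    rw [← ContinuousLinearMap.adjoint_adjoint (1 - P), hP, map_zero]
  have hnorm := hQ.norm
  rw [hP', norm_zero] at hnorm
  refine one_ne_zero (tendsto_nhds_unique (tendsto_const_nhds (x := (1 : ℝ))) (hnorm.congr ?_))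
  exact fun n => norm_one_sub_zeroProjection (h0 _)

/-- The target is metrizable, so closed images can be tested on sequences; a convergent sequence of
projections has base points that subconverge inside the disc. -/
theorem isClosedEmbedding_zeroProjection (hA : ConsistsOfAnalytic H)
    (h0 : ∀ a : 𝔻, kernelAt H a ≠ 0)
    (hi : ∀ a b : 𝔻, a ≠ b → LinearIndependent ℂ ![kernelAt H a, kernelAt H b])
    (hB : BoundaryHypothesis H (fun a : 𝔻 => (a : ℂ))) :
    Topology.IsClosedEmbedding fun a : 𝔻 => zeroProjection H a := by
  have hcont : Continuous fun a : 𝔻 => zeroProjection H a :=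
    (contDiffOn_zeroProjection hA h0).continuousOn.comp_continuous
      isOpenEmbedding_disc_coe.continuous coe_mem_ball
  refine Topology.IsClosedEmbedding.of_continuous_injective_isClosedMap hcont
    (injective_zeroProjection h0 hi) fun C hC => IsSeqClosed.isClosed fun x P hx hlim => ?_
  choose b hbC hb using hx
  obtain rfl : (fun n => zeroProjection H (b n)) = x := funext hb
  obtain ⟨c, s, hs, hc⟩ := exists_subseq_tendsto h0 hB hlim
  refine ⟨c, hC.mem_of_tendsto hc (Filter.Eventually.of_forall fun n => hbC _), ?_⟩
  exact tendsto_nhds_unique ((hcont.tendsto c).comp hc) (hlim.comp hs.tendsto_atTop)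

theorem range_zeroProjection_disc : (Set.range fun a : 𝔻 => zeroProjection H a) =
    zeroProjection H '' Metric.ball 0 1 := by
  ext P
  constructor
  · rintro ⟨a, rfl⟩
    exact ⟨a, coe_mem_ball a, rfl⟩
  · rintro ⟨z, hz, rfl⟩
    obtain ⟨a, rfl⟩ := exists_unitDisc_coe hz
    exact ⟨a, rfl⟩

/-- The embedding property in the form required by the retraction and chart lemmas. -/
theorem image_zeroProjection_mem_nhdsWithin
    (he : Topology.IsClosedEmbedding fun a : 𝔻 => zeroProjection H a) (a : 𝔻) {O : Set ℂ}
    (hO : O ∈ 𝓝 (a : ℂ)) : zeroProjection H '' (Metric.ball 0 1 ∩ O) ∈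
      𝓝[zeroProjection H '' Metric.ball 0 1] (zeroProjection H a) := by
  rw [← range_zeroProjection_disc]
  have h1 := he.isEmbedding.map_nhds_eq a
  rw [← h1, Filter.mem_map]
  filter_upwards [isOpenEmbedding_disc_coe.continuous.continuousAt.preimage_mem_nhds hO] with b hb
  exact ⟨b, ⟨coe_mem_ball b, hb⟩, rfl⟩

theorem injOn_zeroProjection (h0 : ∀ a : 𝔻, kernelAt H a ≠ 0)
    (hi : ∀ a b : 𝔻, a ≠ b → LinearIndependent ℂ ![kernelAt H a, kernelAt H b]) :
    Set.InjOn (zeroProjection H) (Metric.ball 0 1) := by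
  intro x hx y hy hxy
  obtain ⟨a, rfl⟩ := exists_unitDisc_coe hx
  obtain ⟨b, rfl⟩ := exists_unitDisc_coe hy
  rw [injective_zeroProjection h0 hi hxy]

theorem isClosedSubmanifold_zeroSpaces (hA : ConsistsOfAnalytic H)
    (h0 : ∀ a : 𝔻, kernelAt H a ≠ 0)
    (hi : ∀ a b : 𝔻, a ≠ b → LinearIndependent ℂ ![kernelAt H a, kernelAt H b])
    (hM : MoebiusActs H) (hB : BoundaryHypothesis H (fun a : 𝔻 => (a : ℂ))) :
    IsClosedSubmanifold (zeroSpaces H) (grassmannian H) := by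
  have he := isClosedEmbedding_zeroProjection hA h0 hi hB
  have hsub : zeroProjection H '' Metric.ball 0 1 ⊆ grassmannian H := by
    rintro _ ⟨z, hz, rfl⟩
    obtain ⟨a, rfl⟩ := exists_unitDisc_coe hz
    exact zeroProjection_mem_grassmannian (h0 a)
  rw [zeroSpaces_eq h0]
  refine ⟨hsub, ?_, ?_⟩
  · rw [← range_zeroProjection_disc]
    exact he.isClosed_range.preimage continuous_subtype_val
  · rintro _ ⟨z, hz, rfl⟩
    obtain ⟨a, rfl⟩ := exists_unitDisc_coe hz
    set P := zeroProjection H a with hP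
    have hPp : IsStarProjection P := zeroProjection_mem_grassmannian (h0 a)
    have hO : IsOpen {x : H →L[ℂ] H | ‖P * (x - P) * P‖ < 1 / 2 ∧
        ‖(1 - P) * (x - P) * (1 - P)‖ < 1 / 2} :=
      (isOpen_lt (by fun_prop) (by fun_prop)).and (isOpen_lt (by fun_prop) (by fun_prop))
    exact exists_submanifold_chart Metric.isOpen_ball (contDiffOn_zeroProjection hA h0)
      (injOn_zeroProjection h0 hi) hz
      (hasLeftInverse_of_injective (fderiv_zeroProjection_injective hA h0 hi hM a))
      (fun O hO => image_zeroProjection_mem_nhdsWithin he a hO) hsub hO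
      (by rw [Set.mem_ofPred_eq, ← hP]; simp)
      (contDiff_projectionChart P).contDiffOn _
      (hasFDerivAt_projectionChart hPp.isIdempotentElem) (offDiagonal_closedComplemented hPp)
      fun x hx => projectionChart_mem_iff hPp hx.1 hx.2

end Embedding

attribute [local instance] finrank_real_complex_fact'

/-! ### Smoothness of the action on the disc and lifting of curves -/

section MoebiusAction

/-- The action of the Moebius group on the disc, extended to the plane in the last variable. -/
noncomputable def moebiusEval (x : moebiusGroup × ℂ) : ℂ :=
  (moebiusHomeomorph x.1).2 * (((moebiusHomeomorph x.1).1 - x.2) /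
    (1 - conj ((moebiusHomeomorph x.1).1 : ℂ) * x.2))

theorem moebiusEval_coe (φ : moebiusGroup) (a : 𝔻) : moebiusEval (φ, a) = φ.1 a := by
  obtain ⟨p, rfl⟩ := moebiusHomeomorph.symm.surjective φ
  rw [moebiusEval, Homeomorph.apply_symm_apply]
  rfl

theorem contMDiffAt_moebiusEval (φ : moebiusGroup) (a : 𝔻) :
    ContMDiffAt (moebiusI.prod 𝓘(ℝ, ℂ)) 𝓘(ℝ, ℂ) ∞ moebiusEval (φ, (a : ℂ)) := by
  have hc : ContMDiff (moebiusI.prod 𝓘(ℝ, ℂ)) 𝓘(ℝ, ℂ) ∞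
      fun x : moebiusGroup × ℂ => ((moebiusHomeomorph x.1).1 : ℂ) :=
    contMDiff_disc_coe.comp
      (contMDiff_fst.comp (contMDiff_moebiusHomeomorph.comp contMDiff_fst))
  have hw : ContMDiff (moebiusI.prod 𝓘(ℝ, ℂ)) 𝓘(ℝ, ℂ) ∞
      fun x : moebiusGroup × ℂ => ((moebiusHomeomorph x.1).2 : ℂ) :=
    contMDiff_circle_coe.comp
      (contMDiff_snd.comp (contMDiff_moebiusHomeomorph.comp contMDiff_fst))
  have hz : ContMDiff (moebiusI.prod 𝓘(ℝ, ℂ)) 𝓘(ℝ, ℂ) ∞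
      fun x : moebiusGroup × ℂ => x.2 := contMDiff_snd
  have hden := moebius_den_ne_zero (moebiusHomeomorph φ).1 a
  have h : ContDiffAt ℝ ∞ (fun p : ℂ × ℂ × ℂ => p.2.1 * ((p.1 - p.2.2) / (1 - conj p.1 * p.2.2)))
      (((moebiusHomeomorph φ).1 : ℂ), ((moebiusHomeomorph φ).2 : ℂ), (a : ℂ)) := by
    have hconj : ContDiff ℝ ∞ fun p : ℂ × ℂ × ℂ => conj p.1 :=
      Complex.conjCLE.contDiff.comp contDiff_fst
    have hd : ContDiff ℝ ∞ fun p : ℂ × ℂ × ℂ => 1 - conj p.1 * p.2.2 :=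
      contDiff_const.sub (hconj.mul (contDiff_snd.comp contDiff_snd))
    have hn : ContDiff ℝ ∞ fun p : ℂ × ℂ × ℂ => p.1 - p.2.2 :=
      contDiff_fst.sub (contDiff_snd.comp contDiff_snd)
    simp_rw [div_eq_mul_inv]
    exact ContDiffAt.mul (contDiff_fst.comp contDiff_snd).contDiffAt
      (hn.contDiffAt.mul (hd.contDiffAt.inv hden))
  exact h.contMDiffAt.comp (φ, (a : ℂ)) ((hc.prodMk_space (hw.prodMk_space hz)) (φ, (a : ℂ)))

/-- Every tangent vector of the disc is the velocity of a smooth curve in the disc. -/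
theorem exists_curve_unitDisc (c : 𝔻) (w : ℂ) : ∃ κ : ℝ → 𝔻,
    ContDiff ℝ ∞ (fun t => (κ t : ℂ)) ∧ κ 0 = c ∧ HasDerivAt (fun t => (κ t : ℂ)) w 0 := by
  -- The curve will be `c + r * sin (t / r) * w`: its velocity at `0` is `w`, and boundedness of the
  -- sine keeps it in the disc for all times.
  obtain ⟨r, hr, hrw⟩ : ∃ r : ℝ, 0 < r ∧ r * ‖w‖ < 1 - ‖(c : ℂ)‖ := by
    have h1 : 0 < 1 - ‖(c : ℂ)‖ := sub_pos.mpr c.norm_lt_one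
    refine ⟨(1 - ‖(c : ℂ)‖) / (‖w‖ + 1), by positivity, ?_⟩
    rw [div_mul_eq_mul_div, div_lt_iff₀ (by positivity)]
    nlinarith
  have hlt (t : ℝ) : ‖(c : ℂ) + (r * Real.sin (r⁻¹ * t)) • w‖ < 1 := by
    have h1 : ‖(r * Real.sin (r⁻¹ * t)) • w‖ ≤ r * ‖w‖ := by
      rw [norm_smul, norm_mul, Real.norm_of_nonneg hr.le]
      have := Real.abs_sin_le_one (r⁻¹ * t)
      rw [← Real.norm_eq_abs] at this
      have h2 : r * ‖Real.sin (r⁻¹ * t)‖ ≤ r * 1 := by gcongr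
      nlinarith [norm_nonneg w]
    linarith [norm_add_le (c : ℂ) ((r * Real.sin (r⁻¹ * t)) • w)]
  refine ⟨fun t => Complex.UnitDisc.mk _ (hlt t), ?_, ?_, ?_⟩
  · change ContDiff ℝ ∞ fun t : ℝ => (c : ℂ) + (r * Real.sin (r⁻¹ * t)) • w
    fun_prop
  · ext
    change (c : ℂ) + (r * Real.sin (r⁻¹ * 0)) • w = c
    simp
  · change HasDerivAt (fun t : ℝ => (c : ℂ) + (r * Real.sin (r⁻¹ * t)) • w) w 0
    have h1 : HasDerivAt (fun t : ℝ => r * Real.sin (r⁻¹ * t)) 1 0 := by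
      have h2 := ((Real.hasDerivAt_sin (r⁻¹ * 0)).comp 0
        ((hasDerivAt_id (0 : ℝ)).const_mul r⁻¹)).const_mul r
      exact h2.congr_deriv (by simp [hr.ne'])
    simpa using (h1.smul_const w).const_add (c : ℂ)

/-- Curves in the disc lift to curves in the Moebius group, along the orbit map of a point. -/
theorem exists_lift_curve {κ : ℝ → 𝔻} (hκ : ContDiff ℝ ∞ fun t => (κ t : ℂ)) (g : moebiusGroup)
    (a : 𝔻) (h0 : κ 0 = g.1 a) : ∃ σ : ℝ → moebiusGroup, ContMDiff 𝓘(ℝ, ℝ) moebiusI ∞ σ ∧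
      σ 0 = g ∧ ∀ t, (σ t).1 a = κ t := by
  -- A smooth section of the orbit map of `0`. Then `(τ (κ 0))⁻¹ * g` sends `a` to `0`, and `τ (κ
  -- t)` sends `0` to `κ t`.
  set τ : 𝔻 → moebiusGroup := fun c => moebiusHomeomorph.symm (c, 1) with hτ
  have hτ0 (c : 𝔻) : (τ c).1 0 = c := moebiusPerm_apply_zero c
  have hκ' : ContMDiff 𝓘(ℝ, ℝ) 𝓘(ℝ, ℂ) ∞ κ := contMDiff_disc_of_coe hκ.contMDiff
  have hσ : ContMDiff 𝓘(ℝ, ℝ) moebiusI ∞ fun t => τ (κ t) :=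
    contMDiff_moebiusHomeomorph_symm.comp (hκ'.prodMk contMDiff_const)
  refine ⟨fun t => τ (κ t) * ((τ (κ 0))⁻¹ * g), hσ.mul contMDiff_const, ?_, fun t => ?_⟩
  · simp
  · change (τ (κ t)).1 ((τ (κ 0)).1.symm (g.1 a)) = κ t
    rw [← h0]
    nth_rw 2 [← hτ0 (κ 0)]
    rw [Equiv.symm_apply_apply, hτ0]

end MoebiusAction

/-- The range of the derivative of a composition with a submersion. -/
theorem range_mfderiv_comp {F M₀ M V E : Type*} [NormedAddCommGroup F] [NormedSpace ℝ F]
    [TopologicalSpace M₀] [TopologicalSpace M] [ChartedSpace M₀ M] (I : ModelWithCorners ℝ F M₀)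
    [NormedAddCommGroup V] [NormedSpace ℝ V] [NormedAddCommGroup E] [NormedSpace ℝ E]
    {o : M → V} {Φ : V → E} {Φ' : V →L[ℝ] E} {x : M} (hΦ : HasFDerivAt Φ Φ' (o x))
    (ho : MDifferentiableAt I 𝓘(ℝ, V) o x) (hs : Function.Surjective (mfderiv I 𝓘(ℝ, V) o x)) :
    Set.range (mfderiv I 𝓘(ℝ, E) (Φ ∘ o) x) = Set.range Φ' := by
  have hcomp := HasMFDerivAt.comp x hΦ.hasMFDerivAt ho.hasMFDerivAt
  rw [hcomp.mfderiv]
  exact hs.range_comp Φ'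

/-! ### The zero spaces as a homogeneous space -/

section HomogeneousSpace

variable {H : Type*} [NormedAddCommGroup H] [InnerProductSpace ℂ H] [CompleteSpace H]
  [RKHS ℂ H 𝔻 ℂ]

theorem moebiusAct_zeroProjection (h0 : ∀ a : 𝔻, kernelAt H a ≠ 0) (hM : MoebiusActs H)
    (φ : moebiusGroup) (a : 𝔻) :
    moebiusAct φ (zeroProjection H a) = zeroProjection H (φ.1 a) := by
  have h1 : moebiusAct φ (zeroProjection H a) = projOnto (translate φ (zeroSpace H a)) :=
    congrArg (fun S => projOnto (translate φ S)) (range_zeroProjection (h0 a))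
  rw [h1, translate_zeroSpace hM, projOnto_zeroSpace (h0 _)]

/-- Near each of its points, the set of zero spaces has a smooth coordinate. -/
theorem exists_coordinate_zeroProjection (hA : ConsistsOfAnalytic H)
    (h0 : ∀ a : 𝔻, kernelAt H a ≠ 0)
    (hi : ∀ a b : 𝔻, a ≠ b → LinearIndependent ℂ ![kernelAt H a, kernelAt H b])
    (hM : MoebiusActs H) (hB : BoundaryHypothesis H (fun a : 𝔻 => (a : ℂ))) (a : 𝔻) :
    ∃ (W : Set (H →L[ℂ] H)) (ρ : (H →L[ℂ] H) → ℂ), IsOpen W ∧ zeroProjection H a ∈ W ∧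
      ContDiffOn ℝ ∞ ρ W ∧ ∀ b : 𝔻, zeroProjection H b ∈ W → ρ (zeroProjection H b) = b := by
  have he := isClosedEmbedding_zeroProjection hA h0 hi hB
  obtain ⟨W, ρ, hW, haW, hρ, -, -, hρF⟩ := exists_smooth_retraction Metric.isOpen_ball
    (contDiffOn_zeroProjection hA h0) (injOn_zeroProjection h0 hi) (coe_mem_ball a)
    (hasLeftInverse_of_injective (fderiv_zeroProjection_injective hA h0 hi hM a))
    fun O hO => image_zeroProjection_mem_nhdsWithin he a hO
  exact ⟨W, ρ, hW, haW, hρ, fun b hb => hρF b (coe_mem_ball b) hb⟩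

theorem hasFDerivAt_zeroProjection (hA : ConsistsOfAnalytic H)
    (h0 : ∀ a : 𝔻, kernelAt H a ≠ 0) (a : 𝔻) :
    HasFDerivAt (zeroProjection H) (fderiv ℝ (zeroProjection H) a) (a : ℂ) :=
  (((contDiffOn_zeroProjection hA h0).contDiffAt
    (Metric.isOpen_ball.mem_nhds (coe_mem_ball a))).differentiableAt (by simp)).hasFDerivAt

/-- In the local coordinate `ρ`, a curve `γ` of zero spaces is `zeroProjection H ∘ ρ ∘ γ` near time
`0`, so the chain rule gives one inclusion; the other pushes forward curves in the disc. -/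
theorem tangentVectors_zeroSpaces (hA : ConsistsOfAnalytic H)
    (h0 : ∀ a : 𝔻, kernelAt H a ≠ 0)
    (hi : ∀ a b : 𝔻, a ≠ b → LinearIndependent ℂ ![kernelAt H a, kernelAt H b])
    (hM : MoebiusActs H) (hB : BoundaryHypothesis H (fun a : 𝔻 => (a : ℂ))) (a : 𝔻) :
    tangentVectors (zeroSpaces H) (zeroProjection H a) =
      Set.range (fderiv ℝ (zeroProjection H) a) := by
  rw [zeroSpaces_eq h0]
  have hFa := hasFDerivAt_zeroProjection hA h0 a
  ext v
  constructor
  · rintro ⟨γ, hγ0, hγN, hγ⟩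
    obtain ⟨W, ρ, hW, haW, hρ, hρF⟩ := exists_coordinate_zeroProjection hA h0 hi hM hB a
    have hρa : HasFDerivAt ρ (fderiv ℝ ρ (γ 0)) (γ 0) := by
      rw [hγ0]
      exact ((hρ.contDiffAt (hW.mem_nhds haW)).differentiableAt (by simp)).hasFDerivAt
    have h1 := hρa.comp_hasDerivAt (0 : ℝ) hγ
    have h2 : HasFDerivAt (zeroProjection H) (fderiv ℝ (zeroProjection H) a) ((ρ ∘ γ) 0) := by
      rwa [Function.comp_apply, hγ0, hρF a haW]
    have h3 := h2.comp_hasDerivAt (0 : ℝ) h1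
    have h4 : γ =ᶠ[𝓝 0] zeroProjection H ∘ (ρ ∘ γ) := by
      have hmem : γ ⁻¹' W ∈ 𝓝 (0 : ℝ) :=
        hγ.continuousAt.preimage_mem_nhds (hW.mem_nhds (by rwa [hγ0]))
      filter_upwards [hmem] with t ht
      obtain ⟨z, hz, hzt⟩ := hγN t
      obtain ⟨b, rfl⟩ := exists_unitDisc_coe hz
      rw [Set.mem_preimage, ← hzt] at ht
      rw [Function.comp_apply, Function.comp_apply, ← hzt, hρF b ht]
    exact ⟨_, (h3.congr_of_eventuallyEq h4).unique hγ⟩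
  · rintro ⟨w, rfl⟩
    obtain ⟨κ, -, hκ0, hκd⟩ := exists_curve_unitDisc a w
    refine ⟨fun t => zeroProjection H (κ t), by simp only [hκ0], fun t => ⟨_, coe_mem_ball _, rfl⟩, ?_⟩
    rw [← hκ0] at hFa ⊢
    exact hFa.comp_hasDerivAt (0 : ℝ) hκd

/-- The orbit map of a point of the disc is smooth. -/
theorem contMDiffAt_orbit (a : 𝔻) (g : moebiusGroup) :
    ContMDiffAt moebiusI 𝓘(ℝ, ℂ) ∞ (fun h : moebiusGroup => (h.1 a : ℂ)) g := by
  have h1 : (fun h : moebiusGroup => (h.1 a : ℂ)) = fun h => moebiusEval (h, (a : ℂ)) :=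
    funext fun h => (moebiusEval_coe h a).symm
  rw [h1]
  exact (contMDiffAt_moebiusEval g a).comp g
    (contMDiffAt_id.prodMk (contMDiffAt_const (c := (a : ℂ))))

/-- The orbit map of a point of the disc is a submersion. -/
theorem surjective_mfderiv_orbit (a : 𝔻) (g : moebiusGroup) :
    Function.Surjective
      (mfderiv moebiusI 𝓘(ℝ, ℂ) (fun h : moebiusGroup => (h.1 a : ℂ)) g) := by
  intro w
  obtain ⟨κ, hκ, hκ0, hκd⟩ := exists_curve_unitDisc (g.1 a) w
  obtain ⟨σ, hσ, hσ0, hσa⟩ := exists_lift_curve hκ g a hκ0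
  have hσd : HasMFDerivAt 𝓘(ℝ, ℝ) moebiusI σ 0 (mfderiv 𝓘(ℝ, ℝ) moebiusI σ 0) :=
    ((hσ 0).mdifferentiableAt (by simp)).hasMFDerivAt
  subst hσ0
  have hod := ((contMDiffAt_orbit a (σ 0)).mdifferentiableAt (by simp)).hasMFDerivAt
  have h1 := HasMFDerivAt.comp (0 : ℝ) hod hσd
  have h2 : (fun h : moebiusGroup => (h.1 a : ℂ)) ∘ σ = fun t => (κ t : ℂ) :=
    funext fun t => congrArg _ (hσa t)
  rw [h2] at h1
  have h3 := hasMFDerivAt_unique h1 hκd.hasFDerivAt.hasMFDerivAt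
  refine ⟨mfderiv 𝓘(ℝ, ℝ) moebiusI σ 0 (1 : ℝ), ?_⟩
  have h4 := congrArg (fun L : ℝ →L[ℝ] ℂ => L 1) h3
  exact h4.trans (one_smul ℝ (show ℂ from w))

theorem range_mfderiv_orbit (hA : ConsistsOfAnalytic H) (h0 : ∀ a : 𝔻, kernelAt H a ≠ 0)
    (hM : MoebiusActs H) (a : 𝔻) (g : moebiusGroup) :
    Set.range (mfderiv moebiusI 𝓘(ℝ, H →L[ℂ] H)
      (fun h : moebiusGroup => moebiusAct h (zeroProjection H a)) g) =
      Set.range (fderiv ℝ (zeroProjection H) (g.1 a)) := by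
  have hFa := hasFDerivAt_zeroProjection hA h0 (g.1 a)
  have hf : (fun h : moebiusGroup => moebiusAct h (zeroProjection H a)) =
      zeroProjection H ∘ fun h : moebiusGroup => (h.1 a : ℂ) :=
    funext fun h => moebiusAct_zeroProjection h0 hM h a
  rw [hf]
  exact range_mfderiv_comp moebiusI hFa ((contMDiffAt_orbit a g).mdifferentiableAt (by simp))
    (surjective_mfderiv_orbit a g)

/-- Near a given point the action agrees on the zero spaces with `(φ, P) ↦ zeroProjection H
(moebiusEval (φ, ρ P))`, a composition of smooth maps defined on an open set. -/
theorem contMDiffOn_moebiusAct (hA : ConsistsOfAnalytic H)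
    (h0 : ∀ a : 𝔻, kernelAt H a ≠ 0)
    (hi : ∀ a b : 𝔻, a ≠ b → LinearIndependent ℂ ![kernelAt H a, kernelAt H b])
    (hM : MoebiusActs H) (hB : BoundaryHypothesis H (fun a : 𝔻 => (a : ℂ))) :
    ContMDiffOn (moebiusI.prod 𝓘(ℝ, H →L[ℂ] H)) 𝓘(ℝ, H →L[ℂ] H) ∞
      (fun x : moebiusGroup × (H →L[ℂ] H) => moebiusAct x.1 x.2) (Set.univ ×ˢ zeroSpaces H) := by
  rw [zeroSpaces_eq h0]
  rintro ⟨φ, P⟩ ⟨-, z, hz, hzP⟩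
  obtain ⟨a, rfl⟩ := exists_unitDisc_coe hz
  obtain rfl : zeroProjection H a = P := hzP
  obtain ⟨W, ρ, hW, haW, hρ, hρF⟩ := exists_coordinate_zeroProjection hA h0 hi hM hB a
  have hρa : ContMDiffAt 𝓘(ℝ, H →L[ℂ] H) 𝓘(ℝ, ℂ) ∞ ρ (zeroProjection H a) :=
    (hρ.contDiffAt (hW.mem_nhds haW)).contMDiffAt
  have h1 : ContMDiffAt (moebiusI.prod 𝓘(ℝ, H →L[ℂ] H)) (moebiusI.prod 𝓘(ℝ, ℂ)) ∞
      (fun x : moebiusGroup × (H →L[ℂ] H) => (x.1, ρ x.2)) (φ, zeroProjection H a) :=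
    contMDiffAt_fst.prodMk (hρa.comp (φ, zeroProjection H a) contMDiffAt_snd)
  have h2 : ContMDiffAt (moebiusI.prod 𝓘(ℝ, H →L[ℂ] H)) 𝓘(ℝ, ℂ) ∞
      (fun x : moebiusGroup × (H →L[ℂ] H) => moebiusEval (x.1, ρ x.2))
      (φ, zeroProjection H a) := by
    refine ContMDiffAt.comp (φ, zeroProjection H a) (g := moebiusEval) ?_ h1
    rw [hρF a haW]
    exact contMDiffAt_moebiusEval φ a
  have h3 : ContMDiffAt (moebiusI.prod 𝓘(ℝ, H →L[ℂ] H)) 𝓘(ℝ, H →L[ℂ] H) ∞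
      (fun x : moebiusGroup × (H →L[ℂ] H) => zeroProjection H (moebiusEval (x.1, ρ x.2)))
      (φ, zeroProjection H a) := by
    refine ContMDiffAt.comp (φ, zeroProjection H a) (g := zeroProjection H)
      (ContDiffAt.contMDiffAt ?_) h2
    rw [hρF a haW, moebiusEval_coe]
    exact (contDiffOn_zeroProjection hA h0).contDiffAt
      (Metric.isOpen_ball.mem_nhds (coe_mem_ball _))
  have heq (ψ : moebiusGroup) (b : 𝔻) (hb : zeroProjection H b ∈ W) :
      moebiusAct ψ (zeroProjection H b) =
        zeroProjection H (moebiusEval (ψ, ρ (zeroProjection H b))) := by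
    rw [hρF b hb, moebiusEval_coe, moebiusAct_zeroProjection h0 hM]
  refine h3.contMDiffWithinAt.congr_of_eventuallyEq ?_ (heq φ a haW)
  have hmem : Prod.snd ⁻¹' W ∈ 𝓝[Set.univ ×ˢ (zeroProjection H '' Metric.ball 0 1)]
      ((φ, zeroProjection H a) : moebiusGroup × (H →L[ℂ] H)) :=
    mem_nhdsWithin_of_mem_nhds (continuous_snd.continuousAt.preimage_mem_nhds (hW.mem_nhds haW))
  filter_upwards [hmem, self_mem_nhdsWithin]
  rintro ⟨ψ, Q⟩ hQ ⟨-, y, hy, hyQ⟩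
  obtain ⟨b, rfl⟩ := exists_unitDisc_coe hy
  obtain rfl : zeroProjection H b = Q := hyQ
  exact heq ψ b hQ

theorem isHomogeneousSpace_zeroSpaces (hA : ConsistsOfAnalytic H)
    (h0 : ∀ a : 𝔻, kernelAt H a ≠ 0)
    (hi : ∀ a b : 𝔻, a ≠ b → LinearIndependent ℂ ![kernelAt H a, kernelAt H b])
    (hM : MoebiusActs H) (hB : BoundaryHypothesis H (fun a : 𝔻 => (a : ℂ))) :
    IsHomogeneousSpace moebiusI moebiusGroup moebiusAct (zeroSpaces H) := by
  have hact := moebiusAct_zeroProjection h0 hM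
  have hmem (a : 𝔻) : zeroProjection H a ∈ zeroSpaces H := ⟨a, projOnto_zeroSpace (h0 a)⟩
  have hex : ∀ P ∈ zeroSpaces H, ∃ a : 𝔻, zeroProjection H a = P := by
    rintro _ ⟨a, rfl⟩
    exact ⟨a, (projOnto_zeroSpace (h0 a)).symm⟩
  refine ⟨⟨_, hmem 0⟩, ?_, ?_, ?_, ?_, contMDiffOn_moebiusAct hA h0 hi hM hB, ?_, ?_⟩
  · intro g P hP
    obtain ⟨a, rfl⟩ := hex P hP
    rw [hact]
    exact hmem _
  · intro P hP
    obtain ⟨a, rfl⟩ := hex P hP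
    rw [hact]
    rfl
  · intro g h P hP
    obtain ⟨a, rfl⟩ := hex P hP
    rw [hact, hact, hact]
    rfl
  · intro P hP Q hQ
    obtain ⟨a, rfl⟩ := hex P hP
    obtain ⟨b, rfl⟩ := hex Q hQ
    obtain ⟨φ, rfl⟩ := exists_moebius_apply_eq a b
    exact ⟨φ, hact φ a⟩
  · intro P hP g
    obtain ⟨a, rfl⟩ := hex P hP
    rw [hact, tangentVectors_zeroSpaces hA h0 hi hM hB]
    exact range_mfderiv_orbit hA h0 hM a g
  · intro P _ g
    -- The kernel lies in the tangent space of the group, which is finite-dimensional; naming the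
    -- model space explicitly exposes this.
    let S : Submodule ℝ (ℂ × EuclideanSpace ℝ (Fin 1)) :=
      (mfderiv moebiusI 𝓘(ℝ, H →L[ℂ] H) (fun h : moebiusGroup => moebiusAct h P) g).ker
    exact Submodule.ClosedComplemented.of_finiteDimensional (𝕜 := ℝ) S

end HomogeneousSpace

theorem corollary3p8 (H : Type*) [NormedAddCommGroup H] [InnerProductSpace ℂ H] [CompleteSpace H]
    [RKHS ℂ H 𝔻 ℂ]
    (h_analytic : ConsistsOfAnalytic H)
    (h_ne_zero : ∀ a : 𝔻, kernelAt H a ≠ 0)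
    (h_indep : ∀ a b : 𝔻, a ≠ b → LinearIndependent ℂ ![kernelAt H a, kernelAt H b])
    (h_acts : MoebiusActs H)
    (h_boundary : BoundaryHypothesis H (fun a : 𝔻 => (a : ℂ))) :
    IsClosedSubmanifold (zeroSpaces H) (grassmannian H) ∧
    (∀ (φ : moebiusGroup) (a : 𝔻), translate φ (zeroSpace H a) = zeroSpace H (φ.1 a)) ∧
    IsHomogeneousSpace moebiusI moebiusGroup moebiusAct (zeroSpaces H) :=
  ⟨isClosedSubmanifold_zeroSpaces h_analytic h_ne_zero h_indep h_acts h_boundary,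
    translate_zeroSpace h_acts,
    isHomogeneousSpace_zeroSpaces h_analytic h_ne_zero h_indep h_acts h_boundary⟩
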